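/- Let $K\subset\mathbb R^3$ be an oriented polygonal knot: a simple closed polygon with cyclically ordered segments $S_1,\dots,S_m$ with directions $s_1,\dots,s_m\in S^2$. For $\xi\in S^2$ let $p_\xi$ be the orthogonal projection of $K$ with kernel the line spanned by $\xi$, and let $\mathcal O_K$ be the set of $\xi\in S^2$ for which every fibre of $p_\xi$ is empty, or one point, or two points of $K$ that are not vertices. For $\xi\in\mathcal O_K$ the Tait number is $T_K(\xi)=\sum_v s(v)$ over the double points $v$ of the projection, where, looking from the side of $\xi$, $s(v)=+1$ if the oriented upper strand (the one further in the direction $\xi$) has to be turned counterclockwise to coincide with the lower one, and $s(v)=-1$ otherwise. The indicatrix is $I=\Gamma\cup-\Gamma$, where $\Gamma$ is the closed oriented curve on $S^2$ made of the (shortest) arcs of great circle from $s_i$ to $s_{i+1}$ ($i$ modulo $m$), and $-\Gamma$ is the corresponding curve of the oppositely oriented knot, made of the arcs from $-s_{i+1}$ to $-s_i$. Let $\alpha\subset I$ be an open arc of a great circle, shorter than a half circle, that is relatively open in $I$ (near $\alpha$ the set $I$ consists of $\alpha$ alone), and let $p_1\neq p_2$ be two points of $\alpha$. Let $n$ be the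 algebraic number of times that the indicatrix runs along $\alpha$ in the direction from $p_1$ to $p_2$, counted at any point $q$ of $\alpha$ strictly between $p_1$ and $p_2$ that is none of the points $\pm s_i$: each of the $2m$ arcs of $I$ through $q$ counts $+1$ if it has the direction from $p_1$ to $p_2$, and $-1$ if it has the opposite one. Let $\Omega_0$ and $\Omega_1$ be the components of $S^2\setminus I$ that border $\alpha$ from the south, respectively from the north, where $\xi$ is to the north if $(p_1\times p_2)\cdot\xi>0$ and to the south if $(p_1\times p_2)\cdot\xi<0$. Then each of $\Omega_0$, $\Omega_1$ meets $\mathcal O_K$, the Tait number is constant on $\Omega_0\cap\mathcal O_K$ and on $\Omega_1\cap\mathcal O_K$, and its values $T_K(\Omega_0)$, $T_K(\Omega_1)$ there satisfy $$T_K(\Omega_1)=T_K(\Omega_0)+n.$$ -/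

import Mathlib

open Set Metric Topology
open scoped RealInnerProductSpace

/-- Euclidean three-space. -/
abbrev E3 : Type := EuclideanSpace ℝ (Fin 3)

/-- The unit sphere `S²` of Euclidean three-space. -/
def S2 : Set E3 := sphere (0 : E3) 1

/-- The cross product of `ℝ³`. -/
noncomputable def cross (a b : E3) : E3 :=
  WithLp.toLp 2 (crossProduct (WithLp.ofLp a) (WithLp.ofLp b))

/-- The orthogonal projection `p_ξ` with kernel the line spanned by `ξ`, onto the plane `ξ^⊥`. -/
noncomputable def proj (ξ : E3) (x : E3) : E3 := (Submodule.span ℝ {ξ})ᗮ.starProjection x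

/-- The closed arc of great circle from `a` to `b`: the shortest one, for `a`, `b` in `S²` with
`b ≠ -a`; it is the point `a` when `b = a`. -/
def greatArc (a b : E3) : Set E3 :=
  {x | x ∈ S2 ∧ ∃ s t : ℝ, 0 ≤ s ∧ 0 ≤ t ∧ x = s • a + t • b}

/-- The open arc of great circle from `a` to `b`, for linearly independent `a`, `b` in `S²`. -/
def openGreatArc (a b : E3) : Set E3 :=
  {x | x ∈ S2 ∧ ∃ s t : ℝ, 0 < s ∧ 0 < t ∧ x = s • a + t • b}

/-- An open arc of a great circle of `S²` (shorter than a half circle, so that it has a north and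
a south side once it is oriented by two of its points). -/
def IsOpenGreatArc (α : Set E3) : Prop :=
  ∃ a ∈ S2, ∃ b ∈ S2, LinearIndependent ℝ ![a, b] ∧ α = openGreatArc a b

/-- The points to the north of the great circle through `p₁`, `p₂`, oriented from `p₁` to `p₂`. -/
def north (p₁ p₂ : E3) : Set E3 := {ξ | 0 < ⟪cross p₁ p₂, ξ⟫}

/-- The points to the south of the great circle through `p₁`, `p₂`, oriented from `p₁` to `p₂`. -/
def south (p₁ p₂ : E3) : Set E3 := {ξ | ⟪cross p₁ p₂, ξ⟫ < 0}

/-- An oriented polygonal knot with `m` segments: a closed polygon in `ℝ³` with cyclically ordered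
vertices which is simple, that is, whose half-open edges `[vertex i, vertex (i + 1))` are
nondegenerate and pairwise disjoint. -/
structure PLKnot (m : ℕ) [NeZero m] where
  vertex : Fin m → E3
  simple : Set.InjOn
    (fun p : Fin m × ℝ => AffineMap.lineMap (vertex p.1) (vertex (p.1 + 1)) p.2)
    (Set.univ ×ˢ Set.Ico (0 : ℝ) 1)

namespace PLKnot

variable {m : ℕ} [NeZero m] (K : PLKnot m)

/-- The knot as a subset of `ℝ³`. -/
def carrier : Set E3 := ⋃ i, segment ℝ (K.vertex i) (K.vertex (i + 1))

/-- The `i`-th edge, as a vector. -/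
def edge (i : Fin m) : E3 := K.vertex (i + 1) - K.vertex i

/-- The direction `s_i ∈ S²` of the `i`-th edge. -/
noncomputable def dir (i : Fin m) : E3 := ‖K.edge i‖⁻¹ • K.edge i

/-- The fibre over `v` of the projection of the knot along `ξ`. -/
def fiber (ξ v : E3) : Set E3 := {x | x ∈ K.carrier ∧ proj ξ x = v}

/-- The set `O_K` of the `ξ ∈ S²` whose projection is good: every fibre is empty, or one point, or
two interior points (points that are not vertices) of the knot. -/
def good : Set E3 :=
  {ξ | ξ ∈ S2 ∧ ∀ v : E3, (K.fiber ξ v).Subsingleton ∨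
    ∃ x y : E3, x ≠ y ∧ x ∉ Set.range K.vertex ∧ y ∉ Set.range K.vertex ∧ K.fiber ξ v = {x, y}}

/-- The double points of the diagram. -/
def doublePoints (ξ : E3) : Set E3 := {v | (K.fiber ξ v).Nontrivial}

/-- At the point `v` of the diagram, the `i`-th edge passes over the `j`-th edge. -/
def CrossesOver (ξ v : E3) (i j : Fin m) : Prop :=
  ∃ x ∈ openSegment ℝ (K.vertex i) (K.vertex (i + 1)),
  ∃ y ∈ openSegment ℝ (K.vertex j) (K.vertex (j + 1)),
    proj ξ x = v ∧ proj ξ y = v ∧ ⟪ξ, y⟫ < ⟪ξ, x⟫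

open Classical in
/-- The sign of a double point `v` of the diagram of a good projection. Exactly one pair `(i, j)`
contributes, the upper edge `i` and the lower edge `j`. The plane of projection is seen from the
side of `ξ`, so the upper strand has to be turned counterclockwise (by an angle less than `π`) to
coincide with the lower one if and only if `(edge i × edge j) · ξ > 0`. -/
noncomputable def crossingSign (ξ v : E3) : ℤ :=
  ∑ i : Fin m, ∑ j : Fin m,
    if K.CrossesOver ξ v i j then
      ((SignType.sign ⟪cross (K.edge i) (K.edge j), ξ⟫ : SignType) : ℤ)
    else 0

/-- The Tait number with respect to `ξ ∈ O_K`: the sum of the signs of all double points (there are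
finitely many of them, see `finite_doublePoints`). -/
noncomputable def tait (ξ : E3) : ℤ := ∑ᶠ v ∈ K.doublePoints ξ, K.crossingSign ξ v

/-- The oriented arcs of the indicatrix, each given by its initial and its final point: `inl i`
stands for the arc of `Γ` from `s_i` to `s_{i+1}`, and `inr i` for the corresponding arc of `-Γ`, the
curve obtained from the knot with the opposite orientation; it runs from `-s_{i+1}` to `-s_i`. -/
noncomputable def arc : Fin m ⊕ Fin m → E3 × E3
  | Sum.inl i => (K.dir i, K.dir (i + 1))
  | Sum.inr i => (-K.dir (i + 1), -K.dir i)

/-- The underlying set of the indicatrix `I = Γ ∪ -Γ`. -/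
def indicatrix : Set E3 := ⋃ k, greatArc (K.arc k).1 (K.arc k).2

/-- `Ω` is a connected component of `S² \ I`. -/
def IsComponent (Ω : Set E3) : Prop :=
  ∃ ξ ∈ S2 \ K.indicatrix, Ω = connectedComponentIn (S2 \ K.indicatrix) ξ

/-- `t` is the value of the Tait number on `Ω`: there are good projections in `Ω`, and each of them
has Tait number `t`. -/
def IsTaitNumberOn (Ω : Set E3) (t : ℤ) : Prop :=
  (Ω ∩ K.good).Nonempty ∧ ∀ ξ ∈ Ω ∩ K.good, K.tait ξ = t

/-- `q` is an initial or a final point of one of the arcs that make up the indicatrix, that is, one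
of the points `±s_i`. -/
def IsArcEnd (q : E3) : Prop := ∃ k, q = (K.arc k).1 ∨ q = (K.arc k).2

open Classical in
/-- The algebraic number of times that the indicatrix runs in the direction from `p₁` to `p₂`
through `q`, a point between `p₁` and `p₂` which is not an end of an arc, near which the indicatrix
lies on the great circle through `p₁` and `p₂`: each arc through `q` counts `+1` if it has the
orientation from `p₁` to `p₂`, and `-1` if it has the opposite one. -/
noncomputable def algebraicRuns (p₁ p₂ q : E3) : ℤ :=
  ∑ k : Fin m ⊕ Fin m,
    if q ∈ greatArc (K.arc k).1 (K.arc k).2 then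
      ((SignType.sign ⟪cross (K.arc k).1 (K.arc k).2, cross p₁ p₂⟫ : SignType) : ℤ)
    else 0

lemma exists_exit {s t σ τ : ℝ} (hs : s ∈ Ioo (0 : ℝ) 1) (ht : t ∈ Ioo (0 : ℝ) 1)
    (hσ : σ ≠ 0) (hτ : τ ≠ 0) : ∃ r > 0, s + r * σ ∈ Icc (0 : ℝ) 1 ∧ t + r * τ ∈ Icc (0 : ℝ) 1 ∧
      (s + r * σ = 0 ∨ s + r * σ = 1 ∨ t + r * τ = 0 ∨ t + r * τ = 1) := by
  have key : ∀ {s σ : ℝ}, s ∈ Ioo (0 : ℝ) 1 → σ ≠ 0 → ∃ r > 0,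
      (s + r * σ = 0 ∨ s + r * σ = 1) ∧ ∀ r', 0 ≤ r' → r' ≤ r → s + r' * σ ∈ Icc (0 : ℝ) 1 := by
    intro s σ hs hσ
    rcases lt_or_gt_of_ne hσ with h | h
    · refine ⟨-s / σ, div_pos_of_neg_of_neg (by linarith [hs.1]) h, Or.inl (by field_simp; ring),
        fun r' h0 h1 => ?_⟩
      rw [le_div_iff_of_neg h] at h1
      exact ⟨by linarith, by nlinarith [hs.2]⟩
    · refine ⟨(1 - s) / σ, div_pos (by linarith [hs.2]) h, Or.inr (by field_simp; ring),
        fun r' h0 h1 => ?_⟩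
      rw [le_div_iff₀ h] at h1
      exact ⟨by nlinarith [hs.1], by linarith⟩
  obtain ⟨r, hr, hr1, hr2⟩ := key hs hσ
  obtain ⟨q, hq, hq1, hq2⟩ := key ht hτ
  rcases le_total r q with h | h
  · exact ⟨r, hr, hr2 r hr.le le_rfl, hq2 r hr.le h, by tauto⟩
  · exact ⟨q, hq, hr2 q hq.le h, hq2 q hq.le le_rfl, by tauto⟩

/-- The diagram of a good projection has finitely many double points. -/
theorem finite_doublePoints {ξ : E3} (hξ : ξ ∈ K.good) : (K.doublePoints ξ).Finite := by
  let P : Fin m → ℝ → E3 := fun i s => K.vertex i + s • K.edge i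
  have hP0 : ∀ i, P i 0 ∈ Set.range K.vertex := fun i => ⟨i, by simp [P]⟩
  have hP1 : ∀ i, P i 1 ∈ Set.range K.vertex := fun i => ⟨i + 1, by simp [P, edge]⟩
  have hPc : ∀ i, ∀ s ∈ Icc (0 : ℝ) 1, P i s ∈ K.carrier := by
    intro i s hs
    refine mem_iUnion.2 ⟨i, ?_⟩
    rw [segment_eq_image']
    exact ⟨s, hs, rfl⟩
  have hbad : ∀ x y, x ∈ K.carrier → y ∈ K.carrier → proj ξ x = proj ξ y → x ≠ y →
      x ∉ Set.range K.vertex ∧ y ∉ Set.range K.vertex := by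
    intro x y hx hy hxy hne
    have hx' : x ∈ K.fiber ξ (proj ξ y) := ⟨hx, hxy⟩
    have hy' : y ∈ K.fiber ξ (proj ξ y) := ⟨hy, rfl⟩
    rcases hξ.2 (proj ξ y) with h | ⟨a, b, -, ha, hb, h⟩
    · exact absurd (h hx' hy') hne
    · rw [h] at hx' hy'
      constructor
      · rcases hx' with rfl | rfl <;> assumption
      · rcases hy' with rfl | rfl <;> assumption
  have hrep : ∀ v ∈ K.doublePoints ξ, ∃ i j, ∃ s ∈ Ioo (0 : ℝ) 1, ∃ t ∈ Ioo (0 : ℝ) 1,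
      P i s ≠ P j t ∧ proj ξ (P i s) = v ∧ proj ξ (P j t) = v := by
    rintro v ⟨x, hx, y, hy, hne⟩
    obtain ⟨h1, h2⟩ := hbad x y hx.1 hy.1 (hx.2.trans hy.2.symm) hne
    have hpar : ∀ z ∈ K.carrier, z ∉ Set.range K.vertex →
        ∃ i, ∃ s ∈ Ioo (0 : ℝ) 1, P i s = z := by
      intro z hz hz'
      obtain ⟨i, hi⟩ := mem_iUnion.1 hz
      rw [segment_eq_image'] at hi
      obtain ⟨s, hs, rfl⟩ := hi
      refine ⟨i, s, ⟨lt_of_le_of_ne hs.1 ?_, lt_of_le_of_ne hs.2 ?_⟩, rfl⟩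
      · rintro rfl
        exact hz' (hP0 i)
      · rintro rfl
        exact hz' (hP1 i)
    obtain ⟨i, s, hs, rfl⟩ := hpar x hx.1 h1
    obtain ⟨j, t, ht, rfl⟩ := hpar y hy.1 h2
    exact ⟨i, j, s, hs, t, ht, hne, hx.2, hy.2⟩
  choose! I J S hS T hT hne hx hy using hrep
  refine Set.Finite.of_injOn (f := fun v => (I v, J v)) (t := Set.univ)
    (fun _ _ => mem_univ _) ?_ Set.finite_univ
  intro v hv w hw hvw
  by_contra hvw'
  simp only [Prod.mk.injEq] at hvw
  obtain ⟨hI, hJ⟩ := hvw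
  have hxw := hx w hw
  have hyw := hy w hw
  rw [← hI] at hxw
  rw [← hJ] at hyw
  have hxv := hx v hv
  have hyv := hy v hv
  have hσ : S w - S v ≠ 0 := by
    intro h
    rw [sub_eq_zero.1 h, hxv] at hxw
    exact hvw' hxw
  have hτ : T w - T v ≠ 0 := by
    intro h
    rw [sub_eq_zero.1 h, hyv] at hyw
    exact hvw' hyw
  have hline : ∀ r : ℝ, proj ξ (P (I v) (S v + r * (S w - S v))) =
      proj ξ (P (J v) (T v + r * (T w - T v))) := by
    intro r
    have e1 : P (I v) (S v + r * (S w - S v)) =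
        (1 - r) • P (I v) (S v) + r • P (I v) (S w) := by
      simp only [P]; module
    have e2 : P (J v) (T v + r * (T w - T v)) =
        (1 - r) • P (J v) (T v) + r • P (J v) (T w) := by
      simp only [P]; module
    simp only [proj] at hxv hyv hxw hyw ⊢
    rw [e1, e2, map_add, map_add, map_smul, map_smul, map_smul, map_smul, hxv, hyv, hxw, hyw]
  have hcoin : ∀ r : ℝ, S v + r * (S w - S v) ∈ Icc (0 : ℝ) 1 →
      T v + r * (T w - T v) ∈ Icc (0 : ℝ) 1 →
      (S v + r * (S w - S v) = 0 ∨ S v + r * (S w - S v) = 1 ∨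
        T v + r * (T w - T v) = 0 ∨ T v + r * (T w - T v) = 1) →
      P (I v) (S v + r * (S w - S v)) = P (J v) (T v + r * (T w - T v)) := by
    intro r h1 h2 h3
    by_contra hcon
    obtain ⟨hb1, hb2⟩ := hbad _ _ (hPc _ _ h1) (hPc _ _ h2) (hline r) hcon
    rcases h3 with h | h | h | h
    · exact hb1 (h ▸ hP0 _)
    · exact hb1 (h ▸ hP1 _)
    · exact hb2 (h ▸ hP0 _)
    · exact hb2 (h ▸ hP1 _)
  obtain ⟨r, hr, a1, a2, a3⟩ := exists_exit (hS v hv) (hT v hv) hσ hτ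
  obtain ⟨q, hq, b1, b2, b3⟩ := exists_exit (hS v hv) (hT v hv) (neg_ne_zero.2 hσ) (neg_ne_zero.2 hτ)
  have neg_eq : ∀ a b : ℝ, a + q * -b = a + -q * b := fun a b => by ring
  simp only [neg_eq] at b1 b2 b3
  have hA := hcoin r a1 a2 a3
  have hB := hcoin (-q) b1 b2 b3
  apply hne v hv
  have hrq : r + q ≠ 0 := by positivity
  have e : (r + q) • (P (I v) (S v) - P (J v) (T v)) =
      q • (P (I v) (S v + r * (S w - S v)) - P (J v) (T v + r * (T w - T v))) +
      r • (P (I v) (S v + -q * (S w - S v)) - P (J v) (T v + -q * (T w - T v))) := by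
    simp only [P]; module
  rw [hA, hB, sub_self, sub_self, smul_zero, smul_zero, add_zero] at e
  exact sub_eq_zero.1 ((smul_eq_zero.1 e).resolve_left hrq)

end PLKnot

/-! The differences `point j t - point i s` of the points of two edges fill a parallelogram. Edge
`j` passes over edge `i` in the diagram seen from `ξ` exactly when the ray of `ξ` meets the interior
of this parallelogram, and the sign of the crossing is the sign of its determinant. Hence the Tait
number is a sum, over ordered pairs of edges, of signed indicators of cones over parallelograms
(`tait_eq_diagramSum`), a count of preimages under the Gauss map of the pairs of points of the knot.

When the direction moves from `u` to `v`, such an indicator changes by the signed number of times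
the segment crosses the boundary of the cone (`arcCross_parallelogram`, from `arcCross_triangle`).
The sides of the parallelograms are shared by neighbouring pairs with opposite orientations and
cancel in the cyclic sum. Only consecutive edges leave a remainder: their parallelogram is flat with
a corner at `0`, and its two other sides make up an arc of `Γ` or `-Γ`. So the sum changes exactly
by the signed crossings with the indicatrix (`diagramSum_sub`).

This count needs `u` and `v` in general position. Near a good direction the sum is constant
(`diagramSum_eventually_eq`), so generic vectors, which are dense, determine the Tait number. Off
the indicatrix nothing is crossed, which gives one value on each component; from south to north near
`q`, each arc through `q` is crossed once, with its direction as sign (`eventually_arcCross_eq`). -/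

/-! ### Sign patterns of crossings. -/

/-- The contribution of one arc to the signed number of intersections of arcs with a segment: for an
arc from `a` to `b` and a segment from `u` to `v` it is applied to the four determinants
`[a, b, u]`, `[a, b, v]`, `[u, v, a]`, `[u, v, b]`. -/
noncomputable def signedCross (g g' A B : ℝ) : ℤ :=
  if g < 0 ∧ 0 < g' ∧ B < 0 ∧ 0 < A then 1
  else if 0 < g ∧ g' < 0 ∧ 0 < B ∧ A < 0 then -1 else 0

lemma signedCross_neg (g g' A B : ℝ) :
    signedCross (-g) (-g') (-A) (-B) = -signedCross g g' A B := by
  unfold signedCross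
  simp only [Left.neg_neg_iff, Left.neg_pos_iff]
  split_ifs <;> first | rfl | (exfalso; grind)

lemma signedCross_swap (g g' A B : ℝ) :
    signedCross (-g) (-g') B A = -signedCross g g' A B := by
  unfold signedCross
  simp only [Left.neg_neg_iff, Left.neg_pos_iff]
  split_ifs <;> first | rfl | (exfalso; grind)

lemma signedCross_mul {c d e : ℝ} (hc : 0 < c) (hd : 0 < d) (he : 0 < e) (g g' A B : ℝ) :
    signedCross (c * g) (c * g') (d * A) (e * B) = signedCross g g' A B := by
  unfold signedCross
  simp only [mul_pos_iff_of_pos_left hc, mul_pos_iff_of_pos_left hd, mul_pos_iff_of_pos_left he,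
    mul_neg_iff, hc, hd, he, hc.not_gt, hd.not_gt, he.not_gt, true_and, false_and, or_false]

lemma signedCross_zero (A B : ℝ) : signedCross 0 0 A B = 0 := by simp [signedCross]

/-- Cutting an arc at an intermediate point does not change its crossings: whatever the sign of `A +
B`, at most one of the two halves has the sign change of the whole. -/
lemma signedCross_add {g g' A B : ℝ} (h : A + B ≠ 0) :
    signedCross g g' A (A + B) + signedCross g g' (A + B) B = signedCross g g' A B := by
  unfold signedCross
  rcases lt_or_gt_of_ne h with h | h
  all_goals split_ifs <;> first | rfl | (exfalso; grind)

/-- The case of a triangle `a, b, c` in a plane through `0`. If `0 ≤ k`, the segment does not pass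
from one side of the plane to the other. If `k < 0`, the sign conditions on `α, β, γ` say that `0`
is not in the triangle, so its sides run back and forth over one arc shorter than a half circle and
their crossings cancel. -/
lemma signedCross_triangle_of_proportional {α β γ k A B C : ℝ} (hA : A ≠ 0) (hB : B ≠ 0)
    (hC : C ≠ 0) (hsum : A * α + B * β + C * γ = 0)
    (hpos : ¬ (0 ≤ α ∧ 0 ≤ β ∧ 0 ≤ γ)) (hneg : ¬ (α ≤ 0 ∧ β ≤ 0 ∧ γ ≤ 0)) :
    signedCross γ (k * γ) A B + signedCross α (k * α) B C + signedCross β (k * β) C A = 0 := by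
  unfold signedCross
  rcases le_or_gt 0 k with hk | hk
  · have h : ∀ g : ℝ, ¬ (g < 0 ∧ 0 < k * g) ∧ ¬ (0 < g ∧ k * g < 0) := fun g =>
      ⟨fun h => by nlinarith, fun h => by nlinarith⟩
    have hα := h α
    have hβ := h β
    have hγ := h γ
    split_ifs <;> first | rfl | (exfalso; grind)
  · have h1 : ∀ g : ℝ, 0 < k * g ↔ g < 0 := fun g =>
      ⟨fun h => by nlinarith, fun h => by nlinarith⟩
    have h2 : ∀ g : ℝ, k * g < 0 ↔ 0 < g := fun g =>
      ⟨fun h => by nlinarith, fun h => by nlinarith⟩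
    simp only [h1, h2]
    have key : ¬ (0 ≤ A * α ∧ 0 ≤ B * β ∧ 0 ≤ C * γ) := by
      rintro ⟨x, y, z⟩
      have x0 : A * α = 0 := by linarith
      have y0 : B * β = 0 := by linarith
      have z0 : C * γ = 0 := by linarith
      simp only [mul_eq_zero, hA, hB, hC, false_or] at x0 y0 z0
      simp [x0, y0, z0] at hpos
    have key' : ¬ (A * α ≤ 0 ∧ B * β ≤ 0 ∧ C * γ ≤ 0) := fun ⟨x, y, z⟩ =>
      key ⟨by linarith, by linarith, by linarith⟩
    have e1 : ∀ {x : ℝ}, 0 < x → ∀ y, (0 ≤ x * y ↔ 0 ≤ y) ∧ (x * y ≤ 0 ↔ y ≤ 0) := fun h y =>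
      ⟨mul_nonneg_iff_of_pos_left h, by rw [mul_nonpos_iff]; grind⟩
    have e2 : ∀ {x : ℝ}, x < 0 → ∀ y, (0 ≤ x * y ↔ y ≤ 0) ∧ (x * y ≤ 0 ↔ 0 ≤ y) := fun h y =>
      ⟨by rw [mul_nonneg_iff]; grind, by rw [mul_nonpos_iff]; grind⟩
    rcases lt_or_gt_of_ne hA with a | a <;> rcases lt_or_gt_of_ne hB with b | b <;>
    rcases lt_or_gt_of_ne hC with c | c <;>
    simp only [e1, e2, a, b, c, not_lt_of_gt, and_true, and_false, if_false, and_self]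
      at key key' ⊢ <;> clear hsum h1 h2 e1 e2 hA hB hC <;>
    grind

-- Here `p, q, r` and `p', q', r'` are the coordinates of the two ends of the segment in the basis
-- of the triangle. Every pattern of signs either satisfies the identity or contradicts one of the
-- linear relations among the products of coordinates.
set_option maxHeartbeats 4000000 in
lemma signedCross_triangle {p q r p' q' r' A B C : ℝ}
    (hp : p ≠ 0) (hq : q ≠ 0) (hr : r ≠ 0) (hp' : p' ≠ 0) (hq' : q' ≠ 0) (hr' : r' ≠ 0)
    (hA : A = q * r' - q' * r) (hB : B = r * p' - r' * p) (hC : C = p * q' - p' * q)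
    (hA0 : A ≠ 0) (hB0 : B ≠ 0) (hC0 : C ≠ 0) :
    signedCross r r' A B + signedCross p p' B C + signedCross q q' C A =
      (if 0 < p' ∧ 0 < q' ∧ 0 < r' then 1 else 0) - (if 0 < p ∧ 0 < q ∧ 0 < r then 1 else 0) := by
  have h1 : A * p + B * q + C * r = 0 := by rw [hA, hB, hC]; ring
  have h2 : A * p' + B * q' + C * r' = 0 := by rw [hA, hB, hC]; ring
  unfold signedCross
  rcases lt_or_gt_of_ne hp with h3 | h3 <;> rcases lt_or_gt_of_ne hq with h4 | h4 <;>
  rcases lt_or_gt_of_ne hr with h5 | h5 <;> rcases lt_or_gt_of_ne hp' with h6 | h6 <;>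
  rcases lt_or_gt_of_ne hq' with h7 | h7 <;> rcases lt_or_gt_of_ne hr' with h8 | h8 <;>
  simp only [h3, h4, h5, h6, h7, h8, not_lt_of_gt, true_and, false_and, and_true,
    and_false, if_true, if_false, and_self, add_zero, zero_add, sub_self, sub_zero, zero_sub] <;>
  rcases lt_or_gt_of_ne hA0 with a | a <;> rcases lt_or_gt_of_ne hB0 with b | b <;>
  rcases lt_or_gt_of_ne hC0 with c | c <;>
  (first
  | (simp only [a, b, c, not_lt_of_gt, and_true, and_false, if_true, if_false, and_self, add_zero,
        zero_add, Int.reduceNeg, neg_add_cancel, add_neg_cancel]; done)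
  | (exfalso
     have k1 := mul_pos (abs_pos.2 hA0) (abs_pos.2 hp)
     have k2 := mul_pos (abs_pos.2 hB0) (abs_pos.2 hq)
     have k3 := mul_pos (abs_pos.2 hC0) (abs_pos.2 hr)
     have k4 := mul_pos (abs_pos.2 hA0) (abs_pos.2 hp')
     have k5 := mul_pos (abs_pos.2 hB0) (abs_pos.2 hq')
     have k6 := mul_pos (abs_pos.2 hC0) (abs_pos.2 hr')
     have k7 := mul_pos (abs_pos.2 hq) (abs_pos.2 hr')
     have k8 := mul_pos (abs_pos.2 hr) (abs_pos.2 hq')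
     have k9 := mul_pos (abs_pos.2 hr) (abs_pos.2 hp')
     have k10 := mul_pos (abs_pos.2 hr') (abs_pos.2 hp)
     have k11 := mul_pos (abs_pos.2 hp) (abs_pos.2 hq')
     have k12 := mul_pos (abs_pos.2 hp') (abs_pos.2 hq)
     simp only [a, b, c, h3, h4, h5, h6, h7, h8, abs_of_pos, abs_of_neg]
       at k1 k2 k3 k4 k5 k6 k7 k8 k9 k10 k11 k12
     linarith))

/-! ### Determinants, and crossings of arcs with segments. -/

/-- The determinant of three vectors of `ℝ³`. -/
noncomputable def tri (a b c : E3) : ℝ := ⟪cross a b, c⟫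

lemma cross_zero (a b : E3) : cross a b 0 = a 1 * b 2 - a 2 * b 1 := by
  simp [cross, crossProduct]

lemma cross_one (a b : E3) : cross a b 1 = a 2 * b 0 - a 0 * b 2 := by
  simp [cross, crossProduct]

lemma cross_two (a b : E3) : cross a b 2 = a 0 * b 1 - a 1 * b 0 := by
  simp [cross, crossProduct]

lemma inner_eq_sum (a b : E3) : ⟪a, b⟫ = a 0 * b 0 + a 1 * b 1 + a 2 * b 2 := by
  simp [PiLp.inner_apply, Fin.sum_univ_three]; ring

lemma tri_eq (a b c : E3) : tri a b c =
    (a 1 * b 2 - a 2 * b 1) * c 0 + (a 2 * b 0 - a 0 * b 2) * c 1 +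
      (a 0 * b 1 - a 1 * b 0) * c 2 := by
  rw [tri, inner_eq_sum, cross_zero, cross_one, cross_two]

lemma E3_ext {a b : E3} (h0 : a 0 = b 0) (h1 : a 1 = b 1) (h2 : a 2 = b 2) : a = b := by
  ext i; fin_cases i <;> assumption

lemma tri_expand (w e f u : E3) :
    tri w e f • u = tri e f u • w + tri f w u • e + tri w e u • f := by
  apply E3_ext <;> simp [tri_eq] <;> ring

/-- Both sides span the line common to the planes of `a, b` and of `u, v`. When the sign pattern of
`signedCross` holds, up to a common sign all coefficients are positive, so the arc and the segment
themselves share a ray, and not an arc and an antipodal segment. -/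
lemma tri_relation (a b u v : E3) :
    tri a b v • u - tri a b u • v = tri u v a • b - tri u v b • a := by
  apply E3_ext <;> simp [tri_eq] <;> ring

lemma cross_self_eq (a : E3) : cross a a = 0 := by
  apply E3_ext <;> simp [cross_zero, cross_one, cross_two] <;> ring

lemma cross_swap (a b : E3) : cross a b = -cross b a := by
  apply E3_ext <;> simp [cross_zero, cross_one, cross_two] <;> ring

lemma tri_swap (a b c : E3) : tri a b c = -tri b a c := by simp only [tri_eq]; ring

lemma tri_cycle (a b c : E3) : tri a b c = tri b c a := by simp only [tri_eq]; ring

lemma tri_of_cross_eq_zero {a b : E3} (h : cross a b = 0) (c : E3) : tri a b c = 0 := by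
  simp [tri, h]

/-- The signed number (`0`, `1` or `-1`) of intersections of the arc from `a` to `b` with the
central projection of the segment from `u` to `v`; it is `1` if `v` is to the left of the arc. -/
noncomputable def arcCross (a b u v : E3) : ℤ :=
  signedCross (tri a b u) (tri a b v) (tri u v a) (tri u v b)

lemma arcCross_swap (a b u v : E3) : arcCross b a u v = -arcCross a b u v := by
  rw [arcCross, arcCross, ← signedCross_swap, tri_swap b a u, tri_swap b a v]

lemma arcCross_eq_zero_of_cross {a b : E3} (h : cross a b = 0) (u v : E3) :
    arcCross a b u v = 0 := by
  rw [arcCross, tri_of_cross_eq_zero h, tri_of_cross_eq_zero h, signedCross_zero]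

lemma arcCross_smul {c d : ℝ} (hc : 0 < c) (hd : 0 < d) (a b u v : E3) :
    arcCross (c • a) (d • b) u v = arcCross a b u v := by
  have h : ∀ x, tri (c • a) (d • b) x = c * d * tri a b x := fun x => by
    simp [tri_eq]; ring
  have h' : ∀ (c : ℝ) x, tri u v (c • x) = c * tri u v x := fun c x => by
    simp [tri_eq]; ring
  rw [arcCross, h, h, h', h', signedCross_mul (mul_pos hc hd) hc hd, arcCross]

lemma arcCross_split {a b u v : E3} (h : tri u v (a + b) ≠ 0) :
    arcCross a (a + b) u v + arcCross (a + b) b u v = arcCross a b u v := by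
  have h1 : ∀ x, tri a (a + b) x = tri a b x := fun x => by simp [tri_eq]; ring
  have h2 : ∀ x, tri (a + b) b x = tri a b x := fun x => by simp [tri_eq]; ring
  have h3 : tri u v (a + b) = tri u v a + tri u v b := by simp [tri_eq]; ring
  rw [h3] at h
  simp only [arcCross, h1, h2, h3]
  exact signedCross_add h

open Classical in
/-- The indicator function of the open cone spanned by a basis `a`, `b`, `c`. -/
noncomputable def coneInd (a b c u : E3) : ℤ :=
  if 0 < tri b c u / tri a b c ∧ 0 < tri c a u / tri a b c ∧ 0 < tri a b u / tri a b c
  then 1 else 0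

/-- Across a segment, the signed indicator function of a triangular cone changes by the signed
number of intersections of its boundary with the segment. -/
theorem arcCross_triangle {a b c u v : E3}
    (hconv : ∀ x y z : ℝ, 0 ≤ x → 0 ≤ y → 0 ≤ z → x • a + y • b + z • c = 0 →
      x = 0 ∧ y = 0 ∧ z = 0)
    (hab : cross a b = 0 ∨ tri a b u ≠ 0 ∧ tri a b v ≠ 0)
    (hbc : cross b c = 0 ∨ tri b c u ≠ 0 ∧ tri b c v ≠ 0)
    (hca : cross c a = 0 ∨ tri c a u ≠ 0 ∧ tri c a v ≠ 0)
    (ha : tri u v a ≠ 0) (hb : tri u v b ≠ 0) (hc : tri u v c ≠ 0) :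
    arcCross a b u v + arcCross b c u v + arcCross c a u v =
      SignType.sign (tri a b c) * (coneInd a b c v - coneInd a b c u) := by
  have hu := tri_expand a b c u
  have hv := tri_expand a b c v
  have hsum : tri u v a * tri b c u + tri u v b * tri c a u + tri u v c * tri a b u = 0 := by
    simp only [tri_eq]; ring
  have q1 : tri a b c * tri u v a = tri c a u * tri a b v - tri c a v * tri a b u := by
    simp only [tri_eq]; ring
  have q2 : tri a b c * tri u v b = tri a b u * tri b c v - tri a b v * tri b c u := by
    simp only [tri_eq]; ring
  have q3 : tri a b c * tri u v c = tri b c u * tri c a v - tri b c v * tri c a u := by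
    simp only [tri_eq]; ring
  rcases eq_or_ne (tri a b c) 0 with hd | hd
  · rw [hd, sign_zero]
    simp only [SignType.coe_zero, zero_mul]
    rw [hd, zero_smul] at hu hv
    rw [hd, zero_mul] at q1 q2 q3
    -- Vanishing determinants at `u` are allowed only for degenerate sides. Otherwise the triangle
    -- spans a plane, and the determinants at `v` are a common multiple of those at `u`.
    by_cases hz : tri b c u = 0 ∧ tri c a u = 0 ∧ tri a b u = 0
    · have h1 := hab.resolve_right (fun h => h.1 hz.2.2)
      have h2 := hbc.resolve_right (fun h => h.1 hz.1)
      have h3 := hca.resolve_right (fun h => h.1 hz.2.1)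
      rw [arcCross_eq_zero_of_cross h1, arcCross_eq_zero_of_cross h2,
        arcCross_eq_zero_of_cross h3]
      rfl
    · obtain ⟨k, k1, k2, k3⟩ : ∃ k : ℝ, tri b c v = k * tri b c u ∧ tri c a v = k * tri c a u ∧
          tri a b v = k * tri a b u := by
        by_cases z1 : tri b c u = 0
        · by_cases z2 : tri c a u = 0
          · have z3 : tri a b u ≠ 0 := fun h => hz ⟨z1, z2, h⟩
            refine ⟨tri a b v / tri a b u, ?_, ?_, ?_⟩ <;> field_simp <;> linarith
          · refine ⟨tri c a v / tri c a u, ?_, ?_, ?_⟩ <;> field_simp <;> linarith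
        · refine ⟨tri b c v / tri b c u, ?_, ?_, ?_⟩ <;> field_simp <;> linarith
      simp only [arcCross, k1, k2, k3]
      refine signedCross_triangle_of_proportional ha hb hc hsum ?_ ?_
      · rintro ⟨x, y, z⟩
        exact hz (hconv _ _ _ x y z hu.symm)
      · rintro ⟨x, y, z⟩
        have := hconv (-tri b c u) (-tri c a u) (-tri a b u) (by linarith) (by linarith)
          (by linarith) (by
            rw [neg_smul, neg_smul, neg_smul, ← neg_add, ← neg_add, ← hu, neg_zero])
        simp only [neg_eq_zero] at this
        exact hz this
  · have hne : ∀ {x y : E3} (z : E3), tri x y z ≠ 0 → cross x y ≠ 0 := fun z h h' =>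
      h (tri_of_cross_eq_zero h' z)
    have gab := hab.resolve_left (hne c hd)
    have gbc := hbc.resolve_left (hne a (by rwa [← tri_cycle]))
    have gca := hca.resolve_left (hne b (by rwa [tri_cycle]))
    have key := signedCross_triangle (div_ne_zero gbc.1 hd) (div_ne_zero gca.1 hd)
      (div_ne_zero gab.1 hd) (div_ne_zero gbc.2 hd) (div_ne_zero gca.2 hd) (div_ne_zero gab.2 hd)
      (A := tri u v a / tri a b c) (B := tri u v b / tri a b c) (C := tri u v c / tri a b c)
      (by field_simp; linarith) (by field_simp; linarith) (by field_simp; linarith)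
      (div_ne_zero ha hd) (div_ne_zero hb hd) (div_ne_zero hc hd)
    simp only [coneInd]
    rw [← key]
    simp only [arcCross]
    rcases lt_or_gt_of_ne hd with h | h
    · have e : ∀ g g' A B : ℝ, signedCross (g / tri a b c) (g' / tri a b c) (A / tri a b c)
          (B / tri a b c) = -signedCross g g' A B := fun g g' A B => by
        have h' : 0 < -(tri a b c)⁻¹ := by
          rw [neg_pos]; exact inv_lt_zero.2 h
        rw [← signedCross_neg, ← signedCross_mul h' h' h' (-g)]
        congr 1 <;> ring
      rw [e, e, e, sign_neg h]
      simp
      ring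
    · have e : ∀ g g' A B : ℝ, signedCross (g / tri a b c) (g' / tri a b c) (A / tri a b c)
          (B / tri a b c) = signedCross g g' A B := fun g g' A B => by
        have h' : 0 < (tri a b c)⁻¹ := inv_pos.2 h
        rw [← signedCross_mul h' h' h' g]
        congr 1 <;> ring
      rw [e, e, e, sign_pos h]
      simp

/-! ### Cones over parallelograms. -/

/-- The ray spanned by `u` meets the interior of the parallelogram with corner `w` and sides
`e`, `f`. -/
def Meets (w e f u : E3) : Prop :=
  ∃ s ∈ Ioo (0 : ℝ) 1, ∃ t ∈ Ioo (0 : ℝ) 1, ∃ r > (0 : ℝ), w + s • e + t • f = r • u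

lemma tri_smul_right (a b c : E3) (r : ℝ) : tri a b (r • c) = r * tri a b c := by
  simp [tri, inner_smul_right]

lemma coords_of_combination {w e f u : E3} {s t r : ℝ} (h : w + s • e + t • f = r • u) :
    r * tri e f u = tri w e f ∧ r * tri f w u = s * tri w e f ∧ r * tri w e u = t * tri w e f := by
  simp only [← tri_smul_right, ← h]
  refine ⟨?_, ?_, ?_⟩ <;> simp [tri_eq] <;> ring

lemma combination_of_coords {w e f u : E3} (hd : tri w e f ≠ 0)
    (hx : 0 < tri e f u / tri w e f) :
    w + (tri f w u / tri w e f / (tri e f u / tri w e f)) • e +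
      (tri w e u / tri w e f / (tri e f u / tri w e f)) • f =
        (1 / (tri e f u / tri w e f)) • u := by
  have hexp := tri_expand w e f u
  have hu : u = (tri e f u / tri w e f) • w + (tri f w u / tri w e f) • e +
      (tri w e u / tri w e f) • f := by
    rw [div_eq_inv_mul, div_eq_inv_mul, div_eq_inv_mul, mul_smul, mul_smul,
      mul_smul, ← smul_add, ← smul_add, ← hexp, inv_smul_smul₀ hd]
  nth_rw 6 [hu]
  rw [smul_add, smul_add, smul_smul, smul_smul, smul_smul, one_div_mul_cancel hx.ne',
    one_smul, one_div_mul_eq_div, one_div_mul_eq_div]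

/-- The three quotients are the coordinates of `u` in the basis `w, e, f`. Dividing by the first one
scales `u` into the plane of the parallelogram. -/
lemma meets_iff {w e f : E3} (hd : tri w e f ≠ 0) (u : E3) :
    Meets w e f u ↔
      (0 < tri f w u / tri w e f ∧ tri f w u / tri w e f < tri e f u / tri w e f) ∧
      (0 < tri w e u / tri w e f ∧ tri w e u / tri w e f < tri e f u / tri w e f) := by
  constructor
  · rintro ⟨s, hs, t, ht, r, hr, h⟩
    obtain ⟨h1, h2, h3⟩ := coords_of_combination h
    have e1 : tri e f u / tri w e f = 1 / r := by field_simp; linarith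
    have e2 : tri f w u / tri w e f = s / r := by field_simp; linarith
    have e3 : tri w e u / tri w e f = t / r := by field_simp; linarith
    rw [e1, e2, e3]
    exact ⟨⟨div_pos hs.1 hr, div_lt_div_of_pos_right hs.2 hr⟩,
      ⟨div_pos ht.1 hr, div_lt_div_of_pos_right ht.2 hr⟩⟩
  · rintro ⟨⟨h1, h2⟩, h3, h4⟩
    have hx := h1.trans h2
    exact ⟨_, ⟨div_pos h1 hx, (div_lt_one hx).2 h2⟩, _, ⟨div_pos h3 hx, (div_lt_one hx).2 h4⟩, _,
      one_div_pos.2 hx, combination_of_coords hd hx⟩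

open Classical in
/-- The signed indicator function of the open cone over a parallelogram. -/
noncomputable def parallelogramInd (w e f u : E3) : ℤ :=
  if Meets w e f u then ((SignType.sign (tri w e f) : SignType) : ℤ) else 0

/-- Across a segment, the signed indicator function of the cone over a parallelogram changes by the
signed number of intersections of its boundary with the segment. -/
theorem arcCross_parallelogram {w e f u v : E3}
    (hconv : ∀ s ∈ Icc (0 : ℝ) 1, ∀ t ∈ Icc (0 : ℝ) 1, w + s • e + t • f ≠ 0)
    (h1 : cross w (w + e) = 0 ∨ tri w (w + e) u ≠ 0 ∧ tri w (w + e) v ≠ 0)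
    (h2 : cross (w + e) (w + e + f) = 0 ∨
      tri (w + e) (w + e + f) u ≠ 0 ∧ tri (w + e) (w + e + f) v ≠ 0)
    (h3 : cross (w + e + f) (w + f) = 0 ∨
      tri (w + e + f) (w + f) u ≠ 0 ∧ tri (w + e + f) (w + f) v ≠ 0)
    (h4 : cross (w + f) w = 0 ∨ tri (w + f) w u ≠ 0 ∧ tri (w + f) w v ≠ 0)
    (h5 : cross w (w + e + f) = 0 ∨ tri w (w + e + f) u ≠ 0 ∧ tri w (w + e + f) v ≠ 0)
    (ha : tri u v w ≠ 0) (hb : tri u v (w + e) ≠ 0) (hc : tri u v (w + e + f) ≠ 0)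
    (hd : tri u v (w + f) ≠ 0) :
    parallelogramInd w e f v - parallelogramInd w e f u =
      arcCross w (w + e) u v + arcCross (w + e) (w + e + f) u v +
      arcCross (w + e + f) (w + f) u v + arcCross (w + f) w u v := by
  have h5' : cross (w + e + f) w = 0 ∨ tri (w + e + f) w u ≠ 0 ∧ tri (w + e + f) w v ≠ 0 := by
    rw [cross_swap, tri_swap, tri_swap _ w v, neg_eq_zero, neg_ne_zero, neg_ne_zero]
    exact h5
  -- A nontrivial nonnegative combination, divided by the sum of its coefficients, would put `0` in
  -- the parallelogram.
  have hpt : ∀ x y z : ℝ, 0 ≤ x → 0 ≤ y → 0 ≤ z → ∀ E F : E3,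
      (∀ s t : ℝ, 0 ≤ t → t ≤ s → s ≤ 1 → w + s • E + t • F ≠ 0) →
      x • w + y • (w + E) + z • (w + E + F) = 0 → x = 0 ∧ y = 0 ∧ z = 0 := by
    intro x y z hx hy hz E F hEF h
    have hs : x + y + z = 0 := by
      by_contra hs
      have hs' : 0 < x + y + z := lt_of_le_of_ne (by linarith) (Ne.symm hs)
      refine hEF ((y + z) / (x + y + z)) (z / (x + y + z)) (by positivity)
        (div_le_div_of_nonneg_right (by linarith) hs'.le)
        ((div_le_one hs').2 (by linarith)) ?_
      rw [← smul_eq_zero_iff_right hs, ← h, smul_add, smul_add, smul_smul, smul_smul,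
        mul_div_cancel₀ _ hs, mul_div_cancel₀ _ hs]
      module
    exact ⟨by linarith, by linarith, by linarith⟩
  have t1 := arcCross_triangle (a := w) (b := w + e) (c := w + e + f) (u := u) (v := v)
    (fun x y z hx hy hz h => hpt x y z hx hy hz e f (fun s t ht hts hs =>
      hconv s ⟨ht.trans hts, hs⟩ t ⟨ht, hts.trans hs⟩) h) h1 h2 h5' ha hb hc
  have t2 := arcCross_triangle (a := w) (b := w + e + f) (c := w + f) (u := u) (v := v)
    (fun x y z hx hy hz h => by
      have := hpt x z y hx hz hy f e (fun s t ht hts hs => by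
        rw [add_right_comm]
        exact hconv t ⟨ht, hts.trans hs⟩ s ⟨ht.trans hts, hs⟩) (by
          rw [add_right_comm w f e, add_right_comm, h])
      tauto) h5 h3 h4 ha hc hd
  have d1 : tri w (w + e) (w + e + f) = tri w e f := by simp [tri_eq]; ring
  have d2 : tri w (w + e + f) (w + f) = tri w e f := by simp [tri_eq]; ring
  have hs := arcCross_swap w (w + e + f) u v
  -- The diagonal from `w` to `w + e + f` cuts the parallelogram into two triangles. Off its plane
  -- the indicators add up, and its two opposite runs cancel in the crossing count.
  have hind : ∀ x, (cross w (w + e + f) = 0 ∨ tri w (w + e + f) x ≠ 0) →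
      parallelogramInd w e f x = SignType.sign (tri w e f) *
        (coneInd w (w + e) (w + e + f) x + coneInd w (w + e + f) (w + f) x) := by
    intro x hx
    by_cases h0 : tri w e f = 0
    · simp [parallelogramInd, h0]
    have c1 : tri (w + e) (w + e + f) x = tri e f x - tri f w x := by simp [tri_eq]; ring
    have c2 : tri (w + e + f) w x = tri f w x - tri w e x := by simp [tri_eq]; ring
    have c3 : tri w (w + e) x = tri w e x := by simp [tri_eq]; ring
    have c4 : tri (w + e + f) (w + f) x = tri e f x - tri w e x := by simp [tri_eq]; ring
    have c5 : tri (w + f) w x = tri f w x := by simp [tri_eq]; ring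
    have c6 : tri w (w + e + f) x = tri w e x - tri f w x := by simp [tri_eq]; ring
    have hx' : tri w e x - tri f w x ≠ 0 := by
      rw [← c6]
      refine hx.resolve_left fun h => h0 ?_
      rw [← d2]
      exact tri_of_cross_eq_zero h _
    have hx'' : tri w e x / tri w e f ≠ tri f w x / tri w e f := fun h => hx' (by
      field_simp at h; linarith)
    simp only [parallelogramInd, coneInd, meets_iff h0, d1, d2, c1, c2, c3, c4, c5, c6, sub_div]
    -- The order of `Y` and `Z` tells on which side of the diagonal the point lies.
    generalize tri e f x / tri w e f = X at *
    generalize tri f w x / tri w e f = Y at *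
    generalize tri w e x / tri w e f = Z at *
    rcases lt_or_gt_of_ne hx'' with h | h
    · have n1 : ¬ (0 < Z - Y) := by linarith
      simp only [n1, and_false, if_false, add_zero, mul_ite, mul_one, mul_zero]
      congr 1
      apply propext
      constructor
      · rintro ⟨⟨_, _⟩, _, _⟩; exact ⟨by linarith, by linarith, by linarith⟩
      · rintro ⟨_, _, _⟩; exact ⟨⟨by linarith, by linarith⟩, by linarith, by linarith⟩
    · have n1 : ¬ (0 < Y - Z) := by linarith
      simp only [n1, and_false, false_and, if_false, zero_add, mul_ite, mul_one, mul_zero]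
      congr 1
      apply propext
      constructor
      · rintro ⟨⟨_, _⟩, _, _⟩; exact ⟨by linarith, by linarith, by linarith⟩
      · rintro ⟨_, _, _⟩; exact ⟨⟨by linarith, by linarith⟩, by linarith, by linarith⟩
  rw [hind v (h5.imp id And.right), hind u (h5.imp id And.left)]
  rw [d1] at t1
  rw [d2] at t2
  linear_combination -t1 - t2 + hs

/-! ### Generic vectors. -/

/-- A real analytic function which is not identically zero has no zeros at generic points. -/
lemma eventually_residual_ne_zero {f : E3 → ℝ} (hf : AnalyticOnNhd ℝ f univ) {η : E3}
    (hη : f η ≠ 0) : ∀ᶠ u in residual E3, f u ≠ 0 := by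
  refine residual_of_dense_open ?_ ?_
  · exact isOpen_ne_fun (continuousOn_univ.1 hf.continuousOn) continuous_const
  · intro x
    by_contra hx
    rw [mem_closure_iff_frequently, Filter.not_frequently] at hx
    have h0 : f =ᶠ[𝓝 x] 0 := hx.mono fun y hy => not_not.1 hy
    exact hη (hf.eqOn_zero_of_preconnected_of_eventuallyEq_zero isPreconnected_univ (mem_univ x) h0
      (mem_univ η))

lemma analyticOnNhd_tri (a b : E3) : AnalyticOnNhd ℝ (tri a b) univ := fun x _ =>
  (innerSL ℝ (cross a b)).analyticAt x

lemma eventually_residual_tri_ne_zero {a b : E3} (h : cross a b ≠ 0) :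
    ∀ᶠ u in residual E3, tri a b u ≠ 0 :=
  eventually_residual_ne_zero (analyticOnNhd_tri a b) (η := cross a b) (by
    rw [tri, real_inner_self_eq_norm_sq]; positivity)

lemma exists_cross_ne_zero {a : E3} (h : a ≠ 0) : ∃ b, cross a b ≠ 0 := by
  by_contra! hb
  have h1 := hb !₂[1, 0, 0]
  have h2 := hb !₂[0, 1, 0]
  apply h
  have e1 := congrArg (fun x : E3 => x 1) h1
  have e2 := congrArg (fun x : E3 => x 2) h1
  have e3 := congrArg (fun x : E3 => x 2) h2
  simp [cross_one, cross_two] at e1 e2 e3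
  exact E3_ext e3 e2 e1

lemma cross_zero_left (a : E3) : cross 0 a = 0 := by
  apply E3_ext <;> simp [cross_zero, cross_one, cross_two]

lemma cross_zero_right (a : E3) : cross a 0 = 0 := by
  rw [cross_swap, cross_zero_left, neg_zero]

lemma eventually_residual_cross_ne_zero {a : E3} (h : a ≠ 0) :
    ∀ᶠ u in residual E3, cross a u ≠ 0 := by
  obtain ⟨b, hb⟩ := exists_cross_ne_zero h
  filter_upwards [eventually_residual_tri_ne_zero hb] with u hu h0
  refine hu ?_
  rw [← tri_cycle, tri_swap, tri_of_cross_eq_zero h0, neg_zero]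

/-! ### Chords of the knot, and the jump of the diagram sum. -/

namespace PLKnot

variable {m : ℕ} [NeZero m] (K : PLKnot m)

/-- The vector from the `i`-th to the `j`-th vertex. -/
def chord (i j : Fin m) : E3 := K.vertex j - K.vertex i

/-- The parametrization of the `i`-th edge. -/
def point (i : Fin m) (s : ℝ) : E3 := K.vertex i + s • K.edge i

lemma point_zero (i : Fin m) : K.point i 0 = K.vertex i := by simp [point]

lemma point_one (i : Fin m) : K.point i 1 = K.vertex (i + 1) := by simp [point, edge]

lemma point_inj {i j : Fin m} {s t : ℝ} (hs : s ∈ Ico (0 : ℝ) 1) (ht : t ∈ Ico (0 : ℝ) 1)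
    (h : K.point i s = K.point j t) : i = j ∧ s = t := by
  have e : ∀ i s, K.point i s = AffineMap.lineMap (K.vertex i) (K.vertex (i + 1)) s := by
    intro i s
    rw [AffineMap.lineMap_apply_module', point, edge, add_comm]
  rw [e, e] at h
  exact Prod.mk.inj (K.simple (mk_mem_prod (mem_univ i) hs) (mk_mem_prod (mem_univ j) ht) h)

lemma vertex_injective : Function.Injective K.vertex := fun i j h =>
  (K.point_inj (s := 0) (t := 0) (by simp) (by simp) (by rw [point_zero, point_zero, h])).1

lemma edge_ne_zero (i : Fin m) : K.edge i ≠ 0 := fun h => by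
  have := (K.point_inj (i := i) (j := i) (s := 0) (t := 1 / 2) (by simp) (by norm_num)
    (by rw [point, point, h, smul_zero, smul_zero])).2
  norm_num at this

lemma succ_ne (K : PLKnot m) (i : Fin m) : i + 1 ≠ i := fun h =>
  K.edge_ne_zero i (by simp [edge, h])

/-- Otherwise two edges would be the same segment run in opposite directions, with a common
midpoint. -/
lemma succ_succ_ne (K : PLKnot m) (i : Fin m) : i + 1 + 1 ≠ i := fun h => by
  refine K.succ_ne i (K.point_inj (s := 1 / 2) (t := 1 / 2) (by norm_num) (by norm_num) ?_).1
  simp only [point, edge, h]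
  module

lemma chord_ne_zero {i j : Fin m} (h : i ≠ j) : K.chord i j ≠ 0 := fun h' =>
  h (K.vertex_injective (sub_eq_zero.1 h')).symm

lemma chord_self (i : Fin m) : K.chord i i = 0 := sub_self _

lemma chord_succ (i : Fin m) : K.chord i (i + 1) = K.edge i := rfl

lemma chord_succ_left (i : Fin m) : K.chord (i + 1) i = -K.edge i := by
  simp [chord, edge]

lemma exists_point_Ico (i : Fin m) {s : ℝ} (hs : s ∈ Icc (0 : ℝ) 1) :
    ∃ k, ∃ s' ∈ Ico (0 : ℝ) 1, (k = i ∨ k = i + 1) ∧ K.point i s = K.point k s' := by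
  rcases eq_or_lt_of_le hs.2 with h | h
  · exact ⟨i + 1, 0, by simp, Or.inr rfl, by rw [h, point_one, point_zero]⟩
  · exact ⟨i, s, ⟨hs.1, h⟩, Or.inl rfl, rfl⟩

lemma point_ne {i j : Fin m} {s t : ℝ} (hij : i ≠ j) (h1 : j ≠ i + 1) (h2 : i ≠ j + 1)
    (hs : s ∈ Icc (0 : ℝ) 1) (ht : t ∈ Icc (0 : ℝ) 1) : K.point i s ≠ K.point j t := by
  intro h
  obtain ⟨k, s', hs', hk, e⟩ := K.exists_point_Ico i hs
  obtain ⟨l, t', ht', hl, e'⟩ := K.exists_point_Ico j ht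
  have hkl := (K.point_inj hs' ht' (by rw [← e, ← e', h])).1
  rcases hk with rfl | rfl <;> rcases hl with rfl | rfl
  · exact hij hkl
  · exact h2 hkl
  · exact h1 hkl.symm
  · exact hij (add_right_cancel hkl)

/-- A quadratic form which vanishes at `u` if the projections along `u` of the lines of three edges
are concurrent. -/
noncomputable def concurrence (i j k : Fin m) (u : E3) : ℝ :=
  tri (K.edge j) (K.edge k) u * tri (K.vertex i) (K.edge i) u +
  tri (K.edge k) (K.edge i) u * tri (K.vertex j) (K.edge j) u +
  tri (K.edge i) (K.edge j) u * tri (K.vertex k) (K.edge k) u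

/-- Directions of projection in general position with respect to the vertices. -/
structure Generic (u : E3) : Prop where
  tri_ne : ∀ i j k l, cross (K.chord i j) (K.chord k l) = 0 ∨ tri (K.chord i j) (K.chord k l) u ≠ 0
  cross_ne : ∀ i j, i ≠ j → cross (K.chord i j) u ≠ 0
  concurrence_ne : ∀ i j k, (∃ η, K.concurrence i j k η ≠ 0) → K.concurrence i j k u ≠ 0

lemma eventually_generic : ∀ᶠ u in residual E3, K.Generic u := by
  have h1 : ∀ᶠ u in residual E3, ∀ i j k l,
      cross (K.chord i j) (K.chord k l) = 0 ∨ tri (K.chord i j) (K.chord k l) u ≠ 0 := by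
    simp only [Filter.eventually_all]
    intro i j k l
    by_cases h : cross (K.chord i j) (K.chord k l) = 0
    · exact Filter.Eventually.of_forall fun _ => Or.inl h
    · exact (eventually_residual_tri_ne_zero h).mono fun _ => Or.inr
  have h2 : ∀ᶠ u in residual E3, ∀ i j, i ≠ j → cross (K.chord i j) u ≠ 0 := by
    simp only [Filter.eventually_all]
    exact fun i j h => eventually_residual_cross_ne_zero (K.chord_ne_zero h)
  have h3 : ∀ᶠ u in residual E3, ∀ i j k, (∃ η, K.concurrence i j k η ≠ 0) →
      K.concurrence i j k u ≠ 0 := by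
    simp only [Filter.eventually_all]
    rintro i j k ⟨η, h⟩
    refine eventually_residual_ne_zero (f := K.concurrence i j k) ?_ h
    exact (((analyticOnNhd_tri _ _).mul (analyticOnNhd_tri _ _)).add
      ((analyticOnNhd_tri _ _).mul (analyticOnNhd_tri _ _))).add
      ((analyticOnNhd_tri _ _).mul (analyticOnNhd_tri _ _))
  filter_upwards [h1, h2, h3] with u h1 h2 h3
  exact ⟨h1, h2, h3⟩

/-- The second vector is chosen after the first, so that no chord lies in the plane of the two. -/
lemma eventually_tri_chord_ne {u : E3} (hu : K.Generic u) :
    ∀ᶠ v in residual E3, ∀ i j, i ≠ j → tri u v (K.chord i j) ≠ 0 := by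
  simp only [Filter.eventually_all]
  intro i j h
  filter_upwards [eventually_residual_tri_ne_zero (hu.cross_ne i j h)] with v hv
  rwa [← tri_cycle]

/-- An extension of the Tait number to all directions. -/
noncomputable def diagramSum (u : E3) : ℤ :=
  ∑ i : Fin m, ∑ j : Fin m, parallelogramInd (K.chord i j) (-K.edge i) (K.edge j) u

lemma arcCross_dir (i j : Fin m) (u v : E3) :
    arcCross (K.dir i) (K.dir j) u v = arcCross (K.edge i) (K.edge j) u v :=
  arcCross_smul (inv_pos.2 (norm_pos_iff.2 (K.edge_ne_zero i)))
    (inv_pos.2 (norm_pos_iff.2 (K.edge_ne_zero j))) _ _ _ _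

lemma arcCross_neg_dir (i j : Fin m) (u v : E3) :
    arcCross (-K.dir i) (-K.dir j) u v = arcCross (-K.edge i) (-K.edge j) u v := by
  rw [dir, dir, ← smul_neg, ← smul_neg]
  exact arcCross_smul (inv_pos.2 (norm_pos_iff.2 (K.edge_ne_zero i)))
    (inv_pos.2 (norm_pos_iff.2 (K.edge_ne_zero j))) _ _ _ _

/-- The first four terms are the sides of the parallelogram, arranged so that they telescope over
`i` and `j`. If the edges coincide or are consecutive, the determinant vanishes, hence so does the
left side; a corner is `0`, so two or more sides drop out. For consecutive edges the two other sides
join at the sum of the edge vectors, up to sign, and `arcCross_split` turns them into the arc of the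
indicatrix that corrects the formula. -/
lemma parallelogramInd_change {u v : E3} (hu : K.Generic u) (hv : K.Generic v)
    (huv : ∀ i j, i ≠ j → tri u v (K.chord i j) ≠ 0) (i j : Fin m) :
    parallelogramInd (K.chord i j) (-K.edge i) (K.edge j) v -
        parallelogramInd (K.chord i j) (-K.edge i) (K.edge j) u =
      arcCross (K.chord i j) (K.chord (i + 1) j) u v
      - arcCross (K.chord i (j + 1)) (K.chord (i + 1) (j + 1)) u v
      + arcCross (K.chord (i + 1) j) (K.chord (i + 1) (j + 1)) u v
      - arcCross (K.chord i j) (K.chord i (j + 1)) u v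
      + (if j = i + 1 then arcCross (K.arc (Sum.inl i)).1 (K.arc (Sum.inl i)).2 u v else 0)
      + (if i = j + 1 then arcCross (K.arc (Sum.inr j)).1 (K.arc (Sum.inr j)).2 u v else 0) := by
  have zl : ∀ a, arcCross 0 a u v = 0 := fun a => arcCross_eq_zero_of_cross (cross_zero_left a) u v
  have zr : ∀ a, arcCross a 0 u v = 0 := fun a => arcCross_eq_zero_of_cross (cross_zero_right a) u v
  have flat : ∀ {w e f : E3}, tri w e f = 0 → ∀ x, parallelogramInd w e f x = 0 := by
    intro w e f h x
    simp [parallelogramInd, h]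
  by_cases hij : i = j
  · subst hij
    have hf : tri (K.chord i i) (-K.edge i) (K.edge i) = 0 := by simp [chord, tri_eq]
    rw [flat hf, flat hf, if_neg (K.succ_ne i).symm, if_neg (K.succ_ne i).symm, chord_self,
      chord_self, zl, zr, zr, zl]
    rfl
  by_cases h1 : j = i + 1
  · subst h1
    have hf : tri (K.chord i (i + 1)) (-K.edge i) (K.edge (i + 1)) = 0 := by
      rw [chord_succ]; simp [tri_eq]; ring
    have hne := (K.succ_succ_ne i).symm
    have hc : K.chord i (i + 1 + 1) = K.edge i + K.edge (i + 1) := by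
      simp [chord, edge]
    have hs := arcCross_split (a := K.edge i) (b := K.edge (i + 1)) (u := u) (v := v)
      (by rw [← hc]; exact huv _ _ hne)
    rw [flat hf, flat hf, if_pos rfl, if_neg hne, chord_self, zr, zl, hc, chord_succ, chord_succ]
    simp only [arc, arcCross_dir]
    rw [← hs]
    ring
  by_cases h2 : i = j + 1
  · subst h2
    have hf : tri (K.chord (j + 1) j) (-K.edge (j + 1)) (K.edge j) = 0 := by
      rw [chord_succ_left]; simp [tri_eq]; ring
    have hne := (K.succ_succ_ne j)
    have hc : K.chord (j + 1 + 1) j = -K.edge (j + 1) + -K.edge j := by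
      simp [chord, edge]
    have hs := arcCross_split (a := -K.edge (j + 1)) (b := -K.edge j) (u := u) (v := v)
      (by rw [← hc]; exact huv _ _ hne)
    rw [flat hf, flat hf, if_pos rfl, if_neg h1, chord_self, zr, zl, hc, chord_succ_left,
      chord_succ_left]
    simp only [arc, arcCross_neg_dir]
    rw [← hs, arcCross_swap (-K.edge (j + 1) + -K.edge j) (-K.edge j),
      arcCross_swap (-K.edge (j + 1)) (-K.edge (j + 1) + -K.edge j)]
    ring
  rw [if_neg h1, if_neg h2]
  have e1 : K.chord i j + -K.edge i = K.chord (i + 1) j := by simp [chord, edge]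
  have e2 : K.chord i j + K.edge j = K.chord i (j + 1) := by simp [chord, edge]
  have e3 : K.chord (i + 1) j + K.edge j = K.chord (i + 1) (j + 1) := by simp [chord, edge]
  have hg := fun a b c d => (or_and_left.2 ⟨hu.tri_ne a b c d, hv.tri_ne a b c d⟩)
  have hd : i + 1 ≠ j + 1 := fun h => hij (add_right_cancel h)
  rw [arcCross_parallelogram]
  · rw [e1, e2, e3, arcCross_swap (K.chord i (j + 1)),
      arcCross_swap (K.chord i j) (K.chord i (j + 1))]
    ring
  -- A zero in the parallelogram would be a common point of two edges that are not adjacent.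
  · intro s hs t ht h
    apply K.point_ne hij h1 h2 hs ht
    rw [← sub_eq_zero, ← neg_eq_zero, ← h, point, point, chord]
    module
  all_goals try rw [e1]
  all_goals try rw [e2]
  all_goals try rw [e3]
  all_goals first
    | exact hg _ _ _ _
    | exact huv _ _ hij
    | exact huv _ _ (Ne.symm h1)
    | exact huv _ _ hd
    | exact huv _ _ h2

/-- The change of the diagram sum from `u` to `v` is the signed number of intersections of the
indicatrix with the segment from `u` to `v`. -/
theorem diagramSum_sub {u v : E3} (hu : K.Generic u) (hv : K.Generic v)
    (huv : ∀ i j, i ≠ j → tri u v (K.chord i j) ≠ 0) :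
    K.diagramSum v - K.diagramSum u = ∑ k, arcCross (K.arc k).1 (K.arc k).2 u v := by
  simp only [diagramSum, ← Finset.sum_sub_distrib, K.parallelogramInd_change hu hv huv]
  simp only [Finset.sum_sub_distrib, Finset.sum_add_distrib]
  -- Shifting the cyclic indices identifies opposite sides of neighbouring parallelograms, so that
  -- they cancel.
  have s1 : ∑ i : Fin m, ∑ j : Fin m,
      arcCross (K.chord i (j + 1)) (K.chord (i + 1) (j + 1)) u v =
      ∑ i : Fin m, ∑ j : Fin m, arcCross (K.chord i j) (K.chord (i + 1) j) u v :=
    Finset.sum_congr rfl fun i _ => Equiv.sum_comp (Equiv.addRight (1 : Fin m))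
      (fun j => arcCross (K.chord i j) (K.chord (i + 1) j) u v)
  have s2 : ∑ i : Fin m, ∑ j : Fin m,
      arcCross (K.chord (i + 1) j) (K.chord (i + 1) (j + 1)) u v =
      ∑ i : Fin m, ∑ j : Fin m, arcCross (K.chord i j) (K.chord i (j + 1)) u v :=
    Equiv.sum_comp (Equiv.addRight (1 : Fin m))
      (fun i => ∑ j : Fin m, arcCross (K.chord i j) (K.chord i (j + 1)) u v)
  have s3 : ∑ i : Fin m, ∑ j : Fin m, (if i = j + 1 then
      arcCross (K.arc (Sum.inr j)).1 (K.arc (Sum.inr j)).2 u v else 0) =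
      ∑ j : Fin m, arcCross (K.arc (Sum.inr j)).1 (K.arc (Sum.inr j)).2 u v := by
    rw [Finset.sum_comm]
    simp
  rw [s1, s2, s3, Fintype.sum_sum_type]
  simp

end PLKnot

/-! ### Good projections, and the Tait number as the diagram sum. -/

lemma cross_add_right (a b c : E3) : cross a (b + c) = cross a b + cross a c := by
  apply E3_ext <;> simp [cross_zero, cross_one, cross_two] <;> ring

lemma cross_smul_right (a b : E3) (r : ℝ) : cross a (r • b) = r • cross a b := by
  apply E3_ext <;> simp [cross_zero, cross_one, cross_two] <;> ring

lemma tri_self_right (a b : E3) : tri a b b = 0 := by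
  rw [tri_cycle]; exact tri_of_cross_eq_zero (cross_self_eq b) a

lemma tri_self_left (a b : E3) : tri a b a = 0 := by
  rw [tri_swap, tri_self_right, neg_zero]

lemma tri_add_right (a b c d : E3) : tri a b (c + d) = tri a b c + tri a b d :=
  inner_add_right _ _ _

lemma continuous_tri (a b : E3) : Continuous (tri a b) := by
  unfold tri; fun_prop

lemma proj_eq_proj_iff {ξ x y : E3} : proj ξ x = proj ξ y ↔ ∃ r : ℝ, x - y = r • ξ := by
  rw [proj, proj, ← sub_eq_zero, ← map_sub, Submodule.starProjection_apply_eq_zero_iff,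
    Submodule.orthogonal_orthogonal, Submodule.mem_span_singleton]
  simp only [eq_comm]

lemma ne_zero_of_mem_S2 {ξ : E3} (h : ξ ∈ S2) : ξ ≠ 0 := by
  rintro rfl
  simp [S2] at h

namespace PLKnot

variable {m : ℕ} [NeZero m] (K : PLKnot m)

lemma mem_carrier_iff {x : E3} : x ∈ K.carrier ↔ ∃ i, ∃ s ∈ Icc (0 : ℝ) 1, x = K.point i s := by
  simp only [carrier, mem_iUnion, segment_eq_image']
  exact exists_congr fun i => exists_congr fun s => and_congr_right fun _ => eq_comm

lemma point_sub_point (i j : Fin m) (s t : ℝ) :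
    K.point i s - K.point j t = K.chord j i + t • (-K.edge j) + s • K.edge i := by
  simp only [point, chord]; module

variable {K}

/-- If `r ≠ 0`, then `ξ` is in the span of `chord j k` and `edge j`. By `tri_ne` these are parallel,
so `ξ` is parallel to `edge j`, against `cross_ne`. -/
lemma Generic.eq_zero_of_vertex {ξ : E3} (h : K.Generic ξ) {k j : Fin m} {t r : ℝ}
    (hr : K.vertex k - K.point j t = r • ξ) : r = 0 := by
  by_contra hr0
  have hc : r • ξ = K.chord j k + (-t) • K.edge j := by
    rw [← hr, point, chord]; module
  have h1 : cross (K.chord j k) (K.chord j (j + 1)) = 0 := by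
    refine (h.tri_ne j k j (j + 1)).resolve_right fun h' => mul_ne_zero hr0 h' ?_
    rw [← tri_smul_right, hc, tri_add_right, tri_smul_right, chord_succ, tri_self_left,
      tri_self_right, mul_zero, add_zero]
  rw [chord_succ] at h1
  refine h.cross_ne j (j + 1) (K.succ_ne j).symm ((smul_eq_zero_iff_right hr0).1 ?_)
  rw [← cross_smul_right, hc, cross_add_right, cross_smul_right, chord_succ, cross_self_eq,
    cross_swap, h1, smul_zero, neg_zero, add_zero]

/-- Two edges cross transversally in a generic diagram: parallel edges over each other would have a
plane containing `ξ`, and genericity would again make `ξ` parallel to an edge. -/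
lemma Generic.tri_edge_ne_zero {ξ : E3} (h : K.Generic ξ) {i j : Fin m} {s t r : ℝ} (hr0 : r ≠ 0)
    (hr : K.point i s - K.point j t = r • ξ) : tri (K.edge i) (K.edge j) ξ ≠ 0 := by
  rw [point_sub_point, smul_neg, ← neg_smul] at hr
  have h0 := h.tri_ne i (i + 1) j (j + 1)
  rw [chord_succ, chord_succ] at h0
  refine h0.resolve_left fun hc => ?_
  have h1 : cross (K.chord j i) (K.chord j (j + 1)) = 0 := by
    refine (h.tri_ne j i j (j + 1)).resolve_right fun h' => mul_ne_zero hr0 h' ?_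
    have : tri (K.chord j i) (K.edge j) (K.edge i) = 0 := by
      rw [tri_cycle, tri_swap, tri_of_cross_eq_zero hc, neg_zero]
    rw [← tri_smul_right, ← hr, tri_add_right, tri_add_right, tri_smul_right, tri_smul_right,
      chord_succ, tri_self_left, tri_self_right, this]
    ring
  rw [chord_succ] at h1
  refine h.cross_ne j (j + 1) (K.succ_ne j).symm ((smul_eq_zero_iff_right hr0).1 ?_)
  rw [← cross_smul_right, ← hr, cross_add_right, cross_add_right, cross_smul_right,
    cross_smul_right, chord_succ, cross_self_eq, cross_swap _ (K.chord j i),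
    cross_swap _ (K.edge i), h1, hc]
  simp

lemma tri_vertex_edge (i : Fin m) (s : ℝ) (u : E3) :
    tri (K.vertex i) (K.edge i) u = tri (K.point i s) (K.edge i) u := by
  simp [tri_eq, point]; ring

/-- In a generic direction there are no triple points. -/
lemma Generic.not_triple {ξ : E3} (h : K.Generic ξ) {i j k : Fin m} {s t w a b : ℝ} (ha : a ≠ 0)
    (hb : b ≠ 0) (hab : a ≠ b) (hj : K.point j t - K.point i s = a • ξ)
    (hk : K.point k w - K.point i s = b • ξ) : False := by
  have hJ : tri (K.edge i) (K.edge j) ξ ≠ 0 := by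
    rw [tri_swap, neg_ne_zero]
    exact h.tri_edge_ne_zero ha hj
  have hK := h.tri_edge_ne_zero hb hk
  rw [sub_eq_iff_eq_add] at hj hk
  -- The triple point makes `concurrence` vanish at `ξ`. The test vector `edge i + ξ` shows that the
  -- form is not identically zero, because the three points have distinct heights and the crossings
  -- are transversal.
  refine h.concurrence_ne i j k ⟨K.edge i + ξ, ?_⟩ ?_
  · have : K.concurrence i j k (K.edge i + ξ) =
        (b - a) * tri (K.edge i) (K.edge j) ξ * tri (K.edge k) (K.edge i) ξ := by
      rw [concurrence, tri_vertex_edge i s, tri_vertex_edge j t, tri_vertex_edge k w, hj, hk]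
      generalize K.point i s = x
      simp only [tri_eq, PiLp.add_apply, PiLp.smul_apply, smul_eq_mul]
      ring
    rw [this]
    exact mul_ne_zero (mul_ne_zero (sub_ne_zero.2 hab.symm) hJ) hK
  · rw [concurrence, tri_vertex_edge i s, tri_vertex_edge j t, tri_vertex_edge k w, hj, hk]
    generalize K.point i s = x
    simp only [tri_eq, PiLp.add_apply, PiLp.smul_apply, smul_eq_mul]
    ring

/-- Generic directions give good projections. -/
theorem Generic.mem_good {ξ : E3} (h : K.Generic ξ) (hξ : ξ ∈ S2) : ξ ∈ K.good := by
  refine ⟨hξ, fun v => ?_⟩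
  rw [or_iff_not_imp_left, not_subsingleton_iff]
  rintro ⟨x, hx, y, hy, hxy⟩
  obtain ⟨i, s, hs, rfl⟩ := K.mem_carrier_iff.1 hx.1
  obtain ⟨j, t, ht, rfl⟩ := K.mem_carrier_iff.1 hy.1
  have hne : ∀ {x y : E3}, x ≠ y → proj ξ x = proj ξ y → ∃ r : ℝ, r ≠ 0 ∧ x - y = r • ξ := by
    intro x y hxy he
    obtain ⟨r, hr⟩ := proj_eq_proj_iff.1 he
    refine ⟨r, fun h0 => hxy ?_, hr⟩
    rwa [h0, zero_smul, sub_eq_zero] at hr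
  obtain ⟨a, ha, hya⟩ := hne hxy.symm (hy.2.trans hx.2.symm)
  obtain ⟨a', ha', hxa⟩ := hne hxy (hx.2.trans hy.2.symm)
  refine ⟨_, _, hxy, ?_, ?_, ?_⟩
  · rintro ⟨k, hk⟩
    rw [← hk] at hxa
    exact ha' (h.eq_zero_of_vertex hxa)
  · rintro ⟨k, hk⟩
    rw [← hk] at hya
    exact ha (h.eq_zero_of_vertex hya)
  · refine Subset.antisymm (fun z hz => ?_) (by rintro z (rfl | rfl) <;> assumption)
    by_contra hcon
    simp only [mem_insert_iff, mem_singleton_iff, not_or] at hcon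
    obtain ⟨k, w, hw, rfl⟩ := K.mem_carrier_iff.1 hz.1
    obtain ⟨b, hb, hzb⟩ := hne hcon.1 (hz.2.trans hx.2.symm)
    refine h.not_triple ha hb (fun hab => hcon.2 ?_) hya hzb
    rw [hab, ← hzb] at hya
    exact (sub_left_inj.1 hya).symm

/-- Genericity is residual in `E3`, which by itself says nothing about the sphere; scaling carries
generic vectors to it. -/
lemma Generic.smul {u : E3} (h : K.Generic u) {c : ℝ} (hc : c ≠ 0) : K.Generic (c • u) where
  tri_ne i j k l := (h.tri_ne i j k l).imp_right fun h' => by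
    rw [tri_smul_right]; exact mul_ne_zero hc h'
  cross_ne i j hij := by
    rw [cross_smul_right]; exact smul_ne_zero hc (h.cross_ne i j hij)
  concurrence_ne i j k hη := by
    have e : K.concurrence i j k (c • u) = c * c * K.concurrence i j k u := by
      simp only [concurrence, tri_smul_right]; ring
    rw [e]
    exact mul_ne_zero (mul_ne_zero hc hc) (h.concurrence_ne i j k hη)

lemma meets_chord_iff {i j : Fin m} {ξ : E3} :
    Meets (K.chord j i) (-K.edge j) (K.edge i) ξ ↔ ∃ t ∈ Ioo (0 : ℝ) 1, ∃ s ∈ Ioo (0 : ℝ) 1,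
      ∃ r > (0 : ℝ), K.point i s - K.point j t = r • ξ := by
  simp only [Meets, point_sub_point]

lemma crossesOver_iff {i j : Fin m} {ξ v : E3} : K.CrossesOver ξ v i j ↔
    ∃ s ∈ Ioo (0 : ℝ) 1, ∃ t ∈ Ioo (0 : ℝ) 1, proj ξ (K.point i s) = v ∧
      proj ξ (K.point j t) = v ∧ ⟪ξ, K.point j t⟫ < ⟪ξ, K.point i s⟫ := by
  simp only [CrossesOver, openSegment_eq_image', exists_mem_image]
  rfl

lemma exists_pos_of_crossesOver {ξ x y : E3} (h : proj ξ x = proj ξ y)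
    (hlt : ⟪ξ, y⟫ < ⟪ξ, x⟫) : ∃ r > (0 : ℝ), x - y = r • ξ := by
  obtain ⟨r, hr⟩ := proj_eq_proj_iff.1 h
  refine ⟨r, ?_, hr⟩
  have h1 : 0 < ⟪ξ, x - y⟫ := by rw [inner_sub_right]; linarith
  rw [hr, inner_smul_right, real_inner_self_eq_norm_sq] at h1
  by_contra h2
  have := mul_nonpos_of_nonpos_of_nonneg (not_lt.1 h2) (sq_nonneg ‖ξ‖)
  linarith

lemma tri_chord_of_eq {i j : Fin m} {ξ : E3} {s t r : ℝ}
    (h : K.point i s - K.point j t = r • ξ) :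
    tri (K.chord j i) (-K.edge j) (K.edge i) = r * tri (K.edge i) (K.edge j) ξ := by
  rw [← tri_smul_right, ← h, point_sub_point]
  simp [tri_eq]; ring

/-- If the determinant of the edges and `ξ` is nonzero, their projections cross at most once, so at
most one double point contributes. If it is zero, both sides vanish. -/
lemma sum_crossesOver {ξ : E3} (hξ : ξ ∈ K.good) (i j : Fin m) :
    (∑ v ∈ (K.finite_doublePoints hξ).toFinset, open Classical in
      if K.CrossesOver ξ v i j then
        ((SignType.sign ⟪cross (K.edge i) (K.edge j), ξ⟫ : SignType) : ℤ) else 0) =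
      parallelogramInd (K.chord j i) (-K.edge j) (K.edge i) ξ := by
  change (∑ v ∈ (K.finite_doublePoints hξ).toFinset, open Classical in
      if K.CrossesOver ξ v i j then
        ((SignType.sign (tri (K.edge i) (K.edge j) ξ) : SignType) : ℤ) else 0) = _
  have hξ0 := ne_zero_of_mem_S2 hξ.1
  by_cases hM : Meets (K.chord j i) (-K.edge j) (K.edge i) ξ
  · rw [parallelogramInd, if_pos hM]
    obtain ⟨t, ht, s, hs, r, hr, h⟩ := meets_chord_iff.1 hM
    have hsgn : SignType.sign (tri (K.chord j i) (-K.edge j) (K.edge i)) =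
        SignType.sign (tri (K.edge i) (K.edge j) ξ) := by
      rw [tri_chord_of_eq h, sign_mul, sign_pos hr, one_mul]
    have hp : proj ξ (K.point i s) = proj ξ (K.point j t) := proj_eq_proj_iff.2 ⟨r, h⟩
    have hcr : K.CrossesOver ξ (proj ξ (K.point i s)) i j := by
      refine crossesOver_iff.2 ⟨s, hs, t, ht, rfl, hp.symm, ?_⟩
      rw [← sub_pos, ← inner_sub_right, h, inner_smul_right, real_inner_self_eq_norm_sq]
      positivity
    rw [hsgn]
    rcases eq_or_ne (tri (K.edge i) (K.edge j) ξ) 0 with h0 | h0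
    · simp [h0]
    · rw [Finset.sum_eq_single (proj ξ (K.point i s)), if_pos hcr]
      · intro v _ hv
        refine if_neg fun hv' => hv ?_
        obtain ⟨s', hs', t', ht', e1, e2, e3⟩ := crossesOver_iff.1 hv'
        obtain ⟨r', hr', h'⟩ := exists_pos_of_crossesOver (e1.trans e2.symm) e3
        rw [← e1]
        -- Two crossings of the same pair of edges give a linear relation between the edges and `ξ`,
        -- which independence makes trivial.
        have hd : (s' - s) • K.edge i + (t - t') • K.edge j = (r' - r) • ξ := by
          rw [sub_smul r', ← h, ← h']
          simp only [point]; module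
        have hrr : r' - r = 0 := by
          refine (mul_eq_zero.1 ?_).resolve_right h0
          rw [← tri_smul_right, ← hd, tri_add_right, tri_smul_right, tri_smul_right,
            tri_self_left, tri_self_right]
          ring
        have hss : s' - s = 0 := by
          refine (mul_eq_zero.1 ?_).resolve_right h0
          have := congrArg (fun x => tri x (K.edge j) ξ) hd
          simp only [hrr, zero_smul] at this
          simp [tri_eq] at this
          rw [tri_eq]
          linear_combination this
        rw [sub_eq_zero.1 hss]
      · intro hn
        exfalso
        apply hn
        rw [Set.Finite.mem_toFinset]
        refine ⟨_, ⟨K.mem_carrier_iff.2 ⟨i, s, Ioo_subset_Icc_self hs, rfl⟩, rfl⟩,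
          _, ⟨K.mem_carrier_iff.2 ⟨j, t, Ioo_subset_Icc_self ht, rfl⟩, hp.symm⟩, ?_⟩
        rw [← sub_ne_zero, h]
        exact smul_ne_zero hr.ne' hξ0
  · rw [parallelogramInd, if_neg hM]
    refine Finset.sum_eq_zero fun v _ => if_neg fun hv => hM ?_
    obtain ⟨s, hs, t, ht, e1, e2, e3⟩ := crossesOver_iff.1 hv
    obtain ⟨r, hr, h⟩ := exists_pos_of_crossesOver (e1.trans e2.symm) e3
    exact meets_chord_iff.2 ⟨t, ht, s, hs, r, hr, h⟩

theorem tait_eq_diagramSum {ξ : E3} (hξ : ξ ∈ K.good) : K.tait ξ = K.diagramSum ξ := by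
  rw [tait, finsum_mem_eq_finite_toFinset_sum _ (K.finite_doublePoints hξ), diagramSum]
  simp only [crossingSign]
  rw [Finset.sum_comm, Finset.sum_comm (f := fun i j => parallelogramInd _ _ _ _)]
  refine Finset.sum_congr rfl fun i _ => ?_
  rw [Finset.sum_comm]
  exact Finset.sum_congr rfl fun j _ => sum_crossesOver hξ i j

lemma Ioo_of_good {ξ : E3} (hξ : ξ ∈ K.good) {i j : Fin m} {s t r : ℝ} (hr : r ≠ 0)
    (hs : s ∈ Icc (0 : ℝ) 1) (ht : t ∈ Icc (0 : ℝ) 1)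
    (h : K.point i s - K.point j t = r • ξ) : s ∈ Ioo (0 : ℝ) 1 ∧ t ∈ Ioo (0 : ℝ) 1 := by
  have hne : K.point i s ≠ K.point j t := by
    rw [← sub_ne_zero, h]
    exact smul_ne_zero hr (ne_zero_of_mem_S2 hξ.1)
  have hx : K.point i s ∈ K.fiber ξ (proj ξ (K.point i s)) :=
    ⟨K.mem_carrier_iff.2 ⟨i, s, hs, rfl⟩, rfl⟩
  have hy : K.point j t ∈ K.fiber ξ (proj ξ (K.point i s)) :=
    ⟨K.mem_carrier_iff.2 ⟨j, t, ht, rfl⟩, (proj_eq_proj_iff.2 ⟨r, h⟩).symm⟩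
  have hin : ∀ {k : Fin m} {w : ℝ}, w ∈ Icc (0 : ℝ) 1 → K.point k w ∉ Set.range K.vertex →
      w ∈ Ioo (0 : ℝ) 1 := by
    intro k w hw hk
    refine ⟨lt_of_le_of_ne hw.1 ?_, lt_of_le_of_ne hw.2 ?_⟩
    · rintro rfl
      exact hk ⟨k, (K.point_zero k).symm⟩
    · rintro rfl
      exact hk ⟨k + 1, (K.point_one k).symm⟩
  rcases hξ.2 (proj ξ (K.point i s)) with hsub | ⟨a, b, -, ha, hb, hab⟩
  · exact absurd (hsub hx hy) hne
  · rw [hab] at hx hy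
    constructor
    · refine hin hs (k := i) ?_
      rcases hx with hx | hx <;> rw [hx] <;> assumption
    · refine hin ht (k := j) ?_
      rcases hy with hy | hy <;> rw [hy] <;> assumption

/-- Double points of a good projection are not vertices, so the ray of `ξ` misses the boundary of
every nondegenerate parallelogram. Meeting and not meeting its interior are then both open
conditions at `ξ`. -/
theorem diagramSum_eventually_eq {ξ : E3} (hξ : ξ ∈ K.good) :
    ∀ᶠ u in 𝓝 ξ, K.diagramSum u = K.diagramSum ξ := by
  have key : ∀ᶠ u in 𝓝 ξ, ∀ i j, parallelogramInd (K.chord j i) (-K.edge j) (K.edge i) u =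
      parallelogramInd (K.chord j i) (-K.edge j) (K.edge i) ξ := by
    simp only [Filter.eventually_all]
    intro i j
    by_cases h0 : tri (K.chord j i) (-K.edge j) (K.edge i) = 0
    · simp [parallelogramInd, h0]
    have hM := fun u => meets_iff h0 u
    have hclosed : ¬ Meets (K.chord j i) (-K.edge j) (K.edge i) ξ →
        ¬ ((0 ≤ tri (K.edge i) (K.chord j i) ξ / tri (K.chord j i) (-K.edge j) (K.edge i) ∧
          tri (K.edge i) (K.chord j i) ξ / tri (K.chord j i) (-K.edge j) (K.edge i) ≤
            tri (-K.edge j) (K.edge i) ξ / tri (K.chord j i) (-K.edge j) (K.edge i)) ∧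
          (0 ≤ tri (K.chord j i) (-K.edge j) ξ / tri (K.chord j i) (-K.edge j) (K.edge i) ∧
          tri (K.chord j i) (-K.edge j) ξ / tri (K.chord j i) (-K.edge j) (K.edge i) ≤
            tri (-K.edge j) (K.edge i) ξ / tri (K.chord j i) (-K.edge j) (K.edge i))) := by
      rintro hn ⟨⟨y0, y1⟩, z0, z1⟩
      -- If the first coordinate is zero, the inequalities make the other two zero as well, which is
      -- impossible for `ξ ≠ 0`.
      rcases (y0.trans y1).eq_or_lt with hx | hx
      · rw [← hx] at y1 z1
        have hy := le_antisymm y1 y0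
        have hz := le_antisymm z1 z0
        rw [eq_comm] at hx
        simp only [div_eq_zero_iff, h0, or_false] at hx hy hz
        have := tri_expand (K.chord j i) (-K.edge j) (K.edge i) ξ
        rw [hx, hy, hz, zero_smul, zero_smul, zero_smul, add_zero, add_zero] at this
        exact smul_ne_zero h0 (ne_zero_of_mem_S2 hξ.1) this
      · have hc := combination_of_coords h0 hx
        rw [← point_sub_point] at hc
        have hr := one_div_pos.2 hx
        obtain ⟨hs, ht⟩ := Ioo_of_good hξ hr.ne' ⟨div_nonneg z0 hx.le, (div_le_one hx).2 z1⟩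
          ⟨div_nonneg y0 hx.le, (div_le_one hx).2 y1⟩ hc
        exact hn (meets_chord_iff.2 ⟨_, ht, _, hs, _, hr, hc⟩)
    have c := fun a b => (continuous_tri a b).div_const (tri (K.chord j i) (-K.edge j) (K.edge i))
    by_cases h : Meets (K.chord j i) (-K.edge j) (K.edge i) ξ
    · have : ∀ᶠ u in 𝓝 ξ, Meets (K.chord j i) (-K.edge j) (K.edge i) u := by
        simp only [hM] at h ⊢
        exact (((isOpen_lt continuous_const (c _ _)).inter (isOpen_lt (c _ _) (c _ _))).inter
          ((isOpen_lt continuous_const (c _ _)).inter (isOpen_lt (c _ _) (c _ _)))).mem_nhds h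
      filter_upwards [this] with u hu
      rw [parallelogramInd, parallelogramInd, if_pos h, if_pos hu]
    · have : ∀ᶠ u in 𝓝 ξ, ¬ Meets (K.chord j i) (-K.edge j) (K.edge i) u := by
        have ho := ((((isClosed_le continuous_const (c (K.edge i) (K.chord j i))).inter
          (isClosed_le (c _ _) (c (-K.edge j) (K.edge i)))).inter
          ((isClosed_le continuous_const (c (K.chord j i) (-K.edge j))).inter
            (isClosed_le (c _ _) (c (-K.edge j) (K.edge i))))).isOpen_compl).mem_nhds (hclosed h)
        filter_upwards [ho] with u hu hu'
        obtain ⟨⟨a1, a2⟩, a3, a4⟩ := (hM u).1 hu'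
        exact hu ⟨⟨a1.le, a2.le⟩, a3.le, a4.le⟩
      filter_upwards [this] with u hu
      rw [parallelogramInd, parallelogramInd, if_neg h, if_neg hu]
  filter_upwards [key] with u hu
  exact Finset.sum_congr rfl fun i _ => Finset.sum_congr rfl fun j _ => hu j i

end PLKnot

/-! ### Arcs of great circles, radial projection and crossings near a point. -/

instance neBot_nhds_inf_residual (ξ : E3) : (𝓝 ξ ⊓ residual E3).NeBot :=
  Filter.inf_neBot_iff.2 fun _ hs _ hs' => (dense_of_mem_residual hs').inter_nhds_nonempty hs
    |>.mono fun _ h => ⟨h.2, h.1⟩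

lemma cross_cross_self (a b : E3) : cross a (cross a b) = ⟪a, b⟫ • a - ⟪a, a⟫ • b := by
  rw [inner_eq_sum, inner_eq_sum]
  apply E3_ext <;> simp [cross_zero, cross_one, cross_two] <;> ring

lemma norm_of_mem_S2 {a : E3} (h : a ∈ S2) : ‖a‖ = 1 := mem_sphere_zero_iff_norm.1 h

lemma eq_or_eq_neg_of_cross_eq_zero {a b : E3} (ha : a ∈ S2) (hb : b ∈ S2) (h : cross a b = 0) :
    b = a ∨ b = -a := by
  have h1 := cross_cross_self a b
  have ha' := norm_of_mem_S2 ha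
  rw [h, cross_zero_right, real_inner_self_eq_norm_sq, ha', one_pow, one_smul, eq_comm,
    sub_eq_zero] at h1
  have h2 := congrArg norm h1
  rw [norm_smul, ha', mul_one, norm_of_mem_S2 hb, Real.norm_eq_abs] at h2
  rcases eq_or_eq_neg_of_abs_eq h2 with h3 | h3 <;> rw [h3] at h1
  · left; simpa using h1.symm
  · right; simpa using h1.symm

lemma greatArc_subset_pair {a b : E3} (ha : a ∈ S2) (hb : b ∈ S2) (h : cross a b = 0) :
    greatArc a b ⊆ {a, b} := by
  rintro x ⟨hx, s, t, hs, ht, e⟩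
  have hn := norm_of_mem_S2 hx
  have ha' := norm_of_mem_S2 ha
  rcases eq_or_eq_neg_of_cross_eq_zero ha hb h with rfl | rfl
  · rw [← add_smul] at e
    rw [e, norm_smul, ha', mul_one, Real.norm_of_nonneg (add_nonneg hs ht)] at hn
    left
    rw [e, hn, one_smul]
  · rw [smul_neg, ← sub_eq_add_neg, ← sub_smul] at e
    rw [e, norm_smul, ha', mul_one, Real.norm_eq_abs] at hn
    rcases eq_or_eq_neg_of_abs_eq hn with h3 | h3
    · left; rw [e, h3, one_smul]
    · right; rw [e, h3, neg_one_smul]; rfl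

lemma isClosed_greatArc {a b : E3} (ha : a ∈ S2) (hb : b ∈ S2) : IsClosed (greatArc a b) := by
  by_cases h : cross a b = 0
  · exact ((toFinite {a, b}).subset (greatArc_subset_pair ha hb h)).isClosed
  have hn : 0 < tri a b (cross a b) := by
    rw [tri, real_inner_self_eq_norm_sq]; positivity
  -- Coordinates in the basis `a, b, cross a b` replace the existential description by closed
  -- conditions.
  have e : greatArc a b = {x | x ∈ S2 ∧ tri a b x = 0 ∧ 0 ≤ tri b (cross a b) x ∧
      0 ≤ tri (cross a b) a x} := by
    ext x
    refine and_congr_right fun _ => ⟨?_, ?_⟩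
    · rintro ⟨s, t, hs, ht, rfl⟩
      have e1 : tri b (cross a b) (s • a + t • b) = s * tri a b (cross a b) := by
        rw [tri_add_right, tri_smul_right, tri_smul_right, tri_self_left, ← tri_cycle]; ring
      have e2 : tri (cross a b) a (s • a + t • b) = t * tri a b (cross a b) := by
        rw [tri_add_right, tri_smul_right, tri_smul_right, tri_self_right, tri_cycle]; ring
      refine ⟨?_, ?_, ?_⟩
      · rw [tri_add_right, tri_smul_right, tri_smul_right, tri_self_left, tri_self_right]; ring
      · rw [e1]; positivity
      · rw [e2]; positivity
    · rintro ⟨h1, h2, h3⟩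
      refine ⟨tri b (cross a b) x / tri a b (cross a b), tri (cross a b) a x / tri a b (cross a b),
        by positivity, by positivity, ?_⟩
      have := tri_expand a b (cross a b) x
      rw [h1, zero_smul, add_zero] at this
      rw [div_eq_inv_mul, div_eq_inv_mul, mul_smul, mul_smul, ← smul_add, ← this,
        inv_smul_smul₀ hn.ne']
  rw [e]
  exact isClosed_sphere.inter ((isClosed_eq (continuous_tri _ _) continuous_const).inter
    ((isClosed_le continuous_const (continuous_tri _ _)).inter
      (isClosed_le continuous_const (continuous_tri _ _))))

lemma continuousAt_normalize {ξ : E3} (h : ξ ≠ 0) :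
    ContinuousAt (fun x : E3 => ‖x‖⁻¹ • x) ξ :=
  (continuousAt_id.norm.inv₀ (norm_ne_zero_iff.2 h)).smul continuousAt_id

lemma normalize_of_mem_S2 {ξ : E3} (h : ξ ∈ S2) : ‖ξ‖⁻¹ • ξ = ξ := by
  rw [norm_of_mem_S2 h, inv_one, one_smul]

lemma tendsto_normalize {ξ : E3} (h : ξ ∈ S2) :
    Filter.Tendsto (fun x : E3 => ‖x‖⁻¹ • x) (𝓝 ξ) (𝓝 ξ) := by
  have := continuousAt_normalize (ne_zero_of_mem_S2 h)
  rwa [ContinuousAt, normalize_of_mem_S2 h] at this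

lemma normalize_mem_S2 {x : E3} (h : x ≠ 0) : ‖x‖⁻¹ • x ∈ S2 := by
  rw [S2, mem_sphere_zero_iff_norm, norm_smul, norm_inv, norm_norm,
    inv_mul_cancel₀ (norm_ne_zero_iff.2 h)]

lemma eventually_normalize_notMem {C : Set E3} (hC : IsClosed C) {ξ : E3} (hξ : ξ ∈ S2)
    (h : ξ ∉ C) : ∀ᶠ x in 𝓝 ξ, x ≠ 0 ∧ ‖x‖⁻¹ • x ∉ C :=
  (eventually_ne_nhds (ne_zero_of_mem_S2 hξ)).and
    ((tendsto_normalize hξ).eventually_mem (hC.isOpen_compl.mem_nhds h))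

lemma exists_mem_segment_of_arcCross_ne_zero {a b u v : E3} (h : arcCross a b u v ≠ 0) :
    ∃ x ∈ segment ℝ u v, ∃ s t : ℝ, 0 ≤ s ∧ 0 ≤ t ∧ x = s • a + t • b := by
  have hrel := tri_relation a b u v
  have key : ∀ g g' A B : ℝ, g < 0 → 0 < g' → B < 0 → 0 < A →
      g' • u - g • v = A • b - B • a →
      ∃ x ∈ segment ℝ u v, ∃ s t : ℝ, 0 ≤ s ∧ 0 ≤ t ∧ x = s • a + t • b := by
    intro g g' A B hg hg' hB hA hrel
    have hd : 0 < g' - g := by linarith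
    refine ⟨(g' / (g' - g)) • u + (-g / (g' - g)) • v,
      ⟨g' / (g' - g), -g / (g' - g), div_nonneg hg'.le hd.le, div_nonneg (by linarith) hd.le,
        by field_simp; ring, rfl⟩, -B / (g' - g), A / (g' - g), div_nonneg (by linarith) hd.le,
        div_nonneg hA.le hd.le, ?_⟩
    have e1 : (g' / (g' - g)) • u + (-g / (g' - g)) • v = (g' - g)⁻¹ • (g' • u - g • v) := by
      module
    rw [e1, hrel]
    module
  rw [arcCross, signedCross] at h
  split_ifs at h with h1 h2
  · exact key _ _ _ _ h1.1 h1.2.1 h1.2.2.1 h1.2.2.2 hrel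
  · refine key (-tri a b u) (-tri a b v) (-tri u v a) (-tri u v b) (by linarith) (by linarith)
      (by linarith) (by linarith) ?_
    rw [← neg_inj] at hrel
    rw [neg_smul, neg_smul, neg_smul, neg_smul, ← neg_sub', hrel, neg_sub']
  · exact absurd rfl h

lemma arcCross_eq_zero_of_convex {B : Set E3} (hB : Convex ℝ B) {a b : E3}
    (h : ∀ x ∈ B, x ≠ 0 ∧ ‖x‖⁻¹ • x ∉ greatArc a b) {u v : E3} (hu : u ∈ B) (hv : v ∈ B) :
    arcCross a b u v = 0 := by
  by_contra hne
  obtain ⟨x, hx, s, t, hs, ht, e⟩ := exists_mem_segment_of_arcCross_ne_zero hne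
  obtain ⟨h0, h1⟩ := h x (hB.segment_subset hu hv hx)
  refine h1 ⟨normalize_mem_S2 h0, ‖x‖⁻¹ * s, ‖x‖⁻¹ * t, by positivity, by positivity, ?_⟩
  rw [mul_smul, mul_smul, ← smul_add, ← e]

lemma eventually_ball_of_eventually {q : E3} {P : E3 → Prop} (h : ∀ᶠ x in 𝓝 q, P x) :
    ∀ᶠ ε in 𝓝[>] (0 : ℝ), ∀ x ∈ ball q ε, P x := by
  obtain ⟨ε, hε, h⟩ := Metric.eventually_nhds_iff_ball.1 h
  filter_upwards [Ioo_mem_nhdsGT hε] with δ hδ x hx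
  exact h x (ball_subset_ball hδ.2.le hx)

/-- The last four inequalities place `u` and `v` over the open sector between `a` and `b`. A segment
between them that changes side of the plane must cross it within the sector. -/
lemma arcCross_of_sides {a b u v n : E3} {c : ℝ} (hc : c ≠ 0) (hn : cross a b = c • n)
    (hu : ⟪n, u⟫ < 0) (hv : 0 < ⟪n, v⟫)
    (hu1 : 0 < tri (cross a b) a u) (hu2 : 0 < tri b (cross a b) u)
    (hv1 : 0 < tri (cross a b) a v) (hv2 : 0 < tri b (cross a b) v) :
    arcCross a b u v = SignType.sign c := by
  have hγ : ∀ x, tri a b x = c * ⟪n, x⟫ := fun x => by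
    rw [tri, hn, real_inner_smul_left]
  have h0 : cross a b ≠ 0 := fun h => by
    rw [h, tri_of_cross_eq_zero (cross_zero_left _)] at hu1
    exact lt_irrefl _ hu1
  have hN : 0 < tri a b (cross a b) := by
    rw [tri, real_inner_self_eq_norm_sq]; positivity
  have hA : tri u v a * tri a b (cross a b) =
      tri a b v * tri (cross a b) a u - tri a b u * tri (cross a b) a v := by
    generalize cross a b = N
    simp only [tri_eq]; ring
  have hB : tri u v b * tri a b (cross a b) =
      tri a b u * tri b (cross a b) v - tri a b v * tri b (cross a b) u := by
    generalize cross a b = N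
    simp only [tri_eq]; ring
  rw [arcCross, signedCross]
  rcases lt_or_gt_of_ne hc with h | h
  · have gu : 0 < tri a b u := by rw [hγ]; exact mul_pos_of_neg_of_neg h hu
    have gv : tri a b v < 0 := by rw [hγ]; exact mul_neg_of_neg_of_pos h hv
    have A0 : tri u v a < 0 := by
      refine neg_of_mul_neg_left ?_ hN.le
      rw [hA]
      linarith [mul_neg_of_neg_of_pos gv hu1, mul_pos gu hv1]
    have B0 : 0 < tri u v b := by
      refine pos_of_mul_pos_left ?_ hN.le
      rw [hB]
      linarith [mul_neg_of_neg_of_pos gv hu2, mul_pos gu hv2]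
    rw [if_neg (fun h => gu.not_gt h.1), if_pos ⟨gu, gv, B0, A0⟩, sign_neg h]
    rfl
  · have gu : tri a b u < 0 := by rw [hγ]; exact mul_neg_of_pos_of_neg h hu
    have gv : 0 < tri a b v := by rw [hγ]; exact mul_pos h hv
    have A0 : 0 < tri u v a := by
      refine pos_of_mul_pos_left ?_ hN.le
      rw [hA]
      linarith [mul_neg_of_neg_of_pos gu hv1, mul_pos gv hu1]
    have B0 : tri u v b < 0 := by
      refine neg_of_mul_neg_left ?_ hN.le
      rw [hB]
      linarith [mul_neg_of_neg_of_pos gu hv2, mul_pos gv hu2]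
    rw [if_pos ⟨gu, gv, B0, A0⟩, sign_pos h]
    rfl

lemma cross_eq_smul_of_orthogonal {a b n : E3} (hn : n ≠ 0) (ha : ⟪n, a⟫ = 0) (hb : ⟪n, b⟫ = 0) :
    cross a b = (⟪cross a b, n⟫ / ‖n‖ ^ 2) • n := by
  have h1 : cross n (cross a b) = 0 := by
    have : cross n (cross a b) = ⟪n, b⟫ • a - ⟪n, a⟫ • b := by
      apply E3_ext <;> simp [cross_zero, cross_one, cross_two, inner_eq_sum] <;> ring
    rw [this, ha, hb, zero_smul, zero_smul, sub_zero]
  have h2 := cross_cross_self n (cross a b)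
  rw [h1, cross_zero_right, eq_comm, sub_eq_zero, real_inner_self_eq_norm_sq] at h2
  have hN : ‖n‖ ^ 2 ≠ 0 := by positivity
  rw [div_eq_inv_mul, mul_smul, real_inner_comm, h2, inv_smul_smul₀ hN]

/-! ### Local values of the diagram sum, and components. -/

namespace PLKnot

variable {m : ℕ} [NeZero m] (K : PLKnot m)

lemma dir_mem_S2 (i : Fin m) : K.dir i ∈ S2 := normalize_mem_S2 (K.edge_ne_zero i)

lemma neg_mem_S2 {x : E3} (h : x ∈ S2) : -x ∈ S2 := by
  rw [S2, mem_sphere_zero_iff_norm, norm_neg]; exact norm_of_mem_S2 h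

lemma arc_mem_S2 (k : Fin m ⊕ Fin m) : (K.arc k).1 ∈ S2 ∧ (K.arc k).2 ∈ S2 := by
  rcases k with i | i
  · exact ⟨K.dir_mem_S2 i, K.dir_mem_S2 (i + 1)⟩
  · exact ⟨neg_mem_S2 (K.dir_mem_S2 (i + 1)), neg_mem_S2 (K.dir_mem_S2 i)⟩

lemma isClosed_indicatrix : IsClosed K.indicatrix :=
  isClosed_iUnion_of_finite fun k => isClosed_greatArc (K.arc_mem_S2 k).1 (K.arc_mem_S2 k).2

/-- The diagram sum has the value `t` in generic directions near `ξ`. -/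
def HasLocalValue (ξ : E3) (t : ℤ) : Prop := ∀ᶠ u in 𝓝 ξ ⊓ residual E3, K.diagramSum u = t

variable {K}

lemma HasLocalValue.unique {ξ : E3} {t t' : ℤ} (h : K.HasLocalValue ξ t)
    (h' : K.HasLocalValue ξ t') : t = t' := by
  obtain ⟨u, hu, hu'⟩ := (h.and h').exists
  exact hu.symm.trans hu'

lemma hasLocalValue_of_good {ξ : E3} (h : ξ ∈ K.good) : K.HasLocalValue ξ (K.tait ξ) := by
  rw [tait_eq_diagramSum h]
  exact (diagramSum_eventually_eq h).filter_mono inf_le_left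

lemma HasLocalValue.exists_mem {ξ : E3} {t : ℤ} (h : K.HasLocalValue ξ t) {O : Set E3}
    (hO : O ∈ 𝓝 ξ) {P : E3 → Prop} (hP : ∀ᶠ u in residual E3, P u) :
    ∃ u ∈ O, P u ∧ K.diagramSum u = t := by
  have h1 : ∀ᶠ u in 𝓝 ξ ⊓ residual E3, u ∈ O := Filter.mem_inf_of_left hO
  obtain ⟨u, h1, h2, h3⟩ := (h1.and ((hP.filter_mono inf_le_right).and h)).exists
  exact ⟨u, h1, h2, h3⟩

/-- No segment in a small ball around `ξ` crosses the cone over the indicatrix, so all generic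
vectors of the ball in general position to a fixed one `u` give the same sum. These are still
residual. -/
lemma exists_hasLocalValue {ξ : E3} (hξ : ξ ∈ S2 \ K.indicatrix) :
    ∃ t, ∀ᶠ x in 𝓝 ξ, K.HasLocalValue x t := by
  obtain ⟨ε, hε, hball⟩ := Metric.eventually_nhds_iff_ball.1
    (eventually_normalize_notMem K.isClosed_indicatrix hξ.1 hξ.2)
  have h1 : ∀ᶠ u in 𝓝 ξ ⊓ residual E3, u ∈ ball ξ ε := Filter.mem_inf_of_left (ball_mem_nhds ξ hε)
  obtain ⟨u, hu, hgu⟩ := (h1.and (K.eventually_generic.filter_mono inf_le_right)).exists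
  refine ⟨K.diagramSum u, ?_⟩
  filter_upwards [ball_mem_nhds ξ hε] with x hx
  have h2 : ∀ᶠ v in 𝓝 x ⊓ residual E3, v ∈ ball ξ ε :=
    Filter.mem_inf_of_left (isOpen_ball.mem_nhds hx)
  filter_upwards [h2, K.eventually_generic.filter_mono inf_le_right,
    (K.eventually_tri_chord_ne hgu).filter_mono inf_le_right] with v hv hgv huv
  rw [← sub_eq_zero, K.diagramSum_sub hgu hgv huv]
  refine Finset.sum_eq_zero fun k _ => arcCross_eq_zero_of_convex (convex_ball ξ ε) ?_ hu hv
  exact fun y hy => ⟨(hball y hy).1, fun h => (hball y hy).2 (mem_iUnion.2 ⟨k, h⟩)⟩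

lemma IsComponent.subset {Ω : Set E3} (h : K.IsComponent Ω) : Ω ⊆ S2 \ K.indicatrix := by
  obtain ⟨ξ, -, rfl⟩ := h
  exact connectedComponentIn_subset _ _

/-- Local values are unique and persist nearby, so they form a locally constant function on a
connected set. -/
lemma IsComponent.exists_hasLocalValue {Ω : Set E3} (h : K.IsComponent Ω) :
    ∃ t, ∀ ξ ∈ Ω, K.HasLocalValue ξ t := by
  classical
  choose! g hg using fun ξ => PLKnot.exists_hasLocalValue (K := K) (ξ := ξ)
  have hpre : IsPreconnected Ω := by
    obtain ⟨ξ, -, rfl⟩ := h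
    exact isPreconnected_connectedComponentIn
  have hcont : ContinuousOn g Ω := by
    intro ξ hξ
    refine (continuousWithinAt_const (b := g ξ)).congr_of_eventuallyEq ?_ rfl
    filter_upwards [self_mem_nhdsWithin, (hg ξ (h.subset hξ)).filter_mono nhdsWithin_le_nhds]
      with x hx hx'
    exact (hg x (h.subset hx)).self_of_nhds.unique hx'
  have hne : Ω.Nonempty := by
    obtain ⟨ξ, hξ, rfl⟩ := h
    exact ⟨ξ, mem_connectedComponentIn hξ⟩
  obtain ⟨ξ₀, hξ₀⟩ := hne
  refine ⟨g ξ₀, fun ξ hξ => ?_⟩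
  rw [hpre.constant hcont hξ₀ hξ]
  exact (hg ξ (h.subset hξ)).self_of_nhds

/-- A generic vector of a small ball is projected radially to the sphere. The image of the ball is
connected and avoids the indicatrix, so the result stays in the component. -/
lemma IsComponent.inter_good_nonempty {Ω : Set E3} (h : K.IsComponent Ω) :
    (Ω ∩ K.good).Nonempty := by
  obtain ⟨ξ, hξ, rfl⟩ := h
  obtain ⟨ε, hε, hball⟩ := Metric.eventually_nhds_iff_ball.1
    (eventually_normalize_notMem K.isClosed_indicatrix hξ.1 hξ.2)
  have h1 : ∀ᶠ u in 𝓝 ξ ⊓ residual E3, u ∈ ball ξ ε := Filter.mem_inf_of_left (ball_mem_nhds ξ hε)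
  obtain ⟨u, hu, hgu⟩ := (h1.and (K.eventually_generic.filter_mono inf_le_right)).exists
  have hu0 := (hball u hu).1
  refine ⟨‖u‖⁻¹ • u, ?_, (hgu.smul (inv_ne_zero (norm_ne_zero_iff.2 hu0))).mem_good
    (normalize_mem_S2 hu0)⟩
  have hpre : IsPreconnected ((fun x : E3 => ‖x‖⁻¹ • x) '' ball ξ ε) :=
    (convex_ball ξ ε).isPreconnected.image _ fun x hx =>
      (continuousAt_normalize (hball x hx).1).continuousWithinAt
  refine hpre.subset_connectedComponentIn ⟨ξ, mem_ball_self hε, normalize_of_mem_S2 hξ.1⟩ ?_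
    ⟨u, hu, rfl⟩
  rintro _ ⟨x, hx, rfl⟩
  exact ⟨normalize_mem_S2 (hball x hx).1, (hball x hx).2⟩

lemma IsComponent.isTaitNumberOn {Ω : Set E3} (h : K.IsComponent Ω) {t : ℤ}
    (ht : ∀ ξ ∈ Ω, K.HasLocalValue ξ t) : K.IsTaitNumberOn Ω t :=
  ⟨h.inter_good_nonempty, fun ξ hξ => (hasLocalValue_of_good hξ.2).unique (ht ξ hξ.1)⟩

/-- Near an interior point `q` of an arc of the indicatrix, an arc through `q` which lies on a great
circle near `q` is crossed exactly once between the two sides of this circle. -/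
lemma eventually_arcCross_eq {α U : Set E3} (hU : IsOpen U) (hα : K.indicatrix ∩ U = α)
    {n q : E3} (hn : n ≠ 0) (hplane : ∀ x ∈ α, ⟪n, x⟫ = 0) (hq : q ∈ α) (hqe : ¬ K.IsArcEnd q)
    {k : Fin m ⊕ Fin m} (hk : q ∈ greatArc (K.arc k).1 (K.arc k).2) :
    ∀ᶠ ε in 𝓝[>] (0 : ℝ), ∀ u ∈ ball q ε, ∀ v ∈ ball q ε, ⟪n, u⟫ < 0 → 0 < ⟪n, v⟫ →
      arcCross (K.arc k).1 (K.arc k).2 u v =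
        SignType.sign ⟪cross (K.arc k).1 (K.arc k).2, n⟫ := by
  obtain ⟨ha, hb⟩ := K.arc_mem_S2 k
  have hqa : q ≠ (K.arc k).1 := fun h => hqe ⟨k, Or.inl h⟩
  have hqb : q ≠ (K.arc k).2 := fun h => hqe ⟨k, Or.inr h⟩
  have hI : greatArc (K.arc k).1 (K.arc k).2 ⊆ K.indicatrix :=
    subset_iUnion (fun k => greatArc (K.arc k).1 (K.arc k).2) k
  generalize (K.arc k).1 = a at *
  generalize (K.arc k).2 = b at *
  have hab : cross a b ≠ 0 := fun h => by
    rcases greatArc_subset_pair ha hb h hk with h | h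
    exacts [hqa h, hqb h]
  obtain ⟨hqS, s, t, hs, ht, hst⟩ := hk
  have hunit : ∀ {r : ℝ} {x : E3}, 0 ≤ r → x ∈ S2 → q = r • x → q = x := by
    intro r x hr hx e
    have h1 := norm_of_mem_S2 hqS
    rw [e, norm_smul, norm_of_mem_S2 hx, mul_one, Real.norm_of_nonneg hr] at h1
    rw [e, h1, one_smul]
  have hs0 : 0 < s := lt_of_le_of_ne hs fun h => hqb (hunit ht hb (by rw [hst, ← h]; simp))
  have ht0 : 0 < t := lt_of_le_of_ne ht fun h => hqa (hunit hs ha (by rw [hst, ← h]; simp))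
  have hq0 := ne_zero_of_mem_S2 hqS
  have hqU : q ∈ U := by rw [← hα] at hq; exact hq.2
  have hqn := hplane q hq
  -- Moving from `q` a little towards `b` stays on the arc and in `U`, hence in `α` and in its
  -- plane. So `b`, and then `a`, lie in this plane.
  have hbn : ⟪n, b⟫ = 0 := by
    have hcont : Filter.Tendsto (fun δ : ℝ => q + δ • b) (𝓝 0) (𝓝 q) := by
      have : Continuous (fun δ : ℝ => q + δ • b) := by fun_prop
      simpa using this.tendsto 0
    have hev : ∀ᶠ x in 𝓝 q, x ≠ 0 ∧ ‖x‖⁻¹ • x ∈ U :=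
      (eventually_ne_nhds hq0).and ((tendsto_normalize hqS).eventually_mem (hU.mem_nhds hqU))
    obtain ⟨δ, ⟨h0, h1⟩, hδ⟩ := (((hcont.eventually hev).filter_mono nhdsWithin_le_nhds).and
      (self_mem_nhdsWithin (s := Ioi (0 : ℝ)))).exists
    have hδ' : (0 : ℝ) < δ := hδ
    have hmem : ‖q + δ • b‖⁻¹ • (q + δ • b) ∈ greatArc a b := by
      refine ⟨normalize_mem_S2 h0, ‖q + δ • b‖⁻¹ * s, ‖q + δ • b‖⁻¹ * (t + δ), by positivity,
        by positivity, ?_⟩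
      rw [mul_smul, mul_smul, ← smul_add]
      nth_rw 2 [hst]
      rw [add_smul, add_assoc]
    have h2 := hplane _ (by rw [← hα]; exact ⟨hI hmem, h1⟩)
    rw [real_inner_smul_right, inner_add_right, hqn, zero_add, real_inner_smul_right] at h2
    have h3 : ‖q + δ • b‖⁻¹ ≠ 0 := inv_ne_zero (norm_ne_zero_iff.2 h0)
    simpa [h3, hδ'.ne'] using h2
  have han : ⟪n, a⟫ = 0 := by
    rw [hst, inner_add_right, real_inner_smul_right, real_inner_smul_right, hbn] at hqn
    simpa [hs0.ne'] using hqn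
  have hpar := cross_eq_smul_of_orthogonal hn han hbn
  have hN : 0 < ‖n‖ ^ 2 := by positivity
  have hc : ⟪cross a b, n⟫ / ‖n‖ ^ 2 ≠ 0 := fun h => hab (by rw [hpar, h, zero_smul])
  have hsign : SignType.sign (⟪cross a b, n⟫ / ‖n‖ ^ 2) = SignType.sign ⟪cross a b, n⟫ := by
    rw [div_eq_mul_inv, sign_mul, sign_pos (inv_pos.2 hN), mul_one]
  have hD : 0 < tri a b (cross a b) := by
    rw [tri, real_inner_self_eq_norm_sq]; positivity
  have h1 : 0 < tri (cross a b) a q := by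
    rw [hst, tri_add_right, tri_smul_right, tri_smul_right, tri_self_right, tri_cycle]
    positivity
  have h2 : 0 < tri b (cross a b) q := by
    rw [hst, tri_add_right, tri_smul_right, tri_smul_right, tri_self_left, ← tri_cycle]
    positivity
  have hev : ∀ᶠ x in 𝓝 q, 0 < tri (cross a b) a x ∧ 0 < tri b (cross a b) x :=
    ((continuous_tri _ _).tendsto q |>.eventually (lt_mem_nhds h1)).and
      ((continuous_tri _ _).tendsto q |>.eventually (lt_mem_nhds h2))
  filter_upwards [eventually_ball_of_eventually hev] with ε hε u hu v hv hu' hv'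
  rw [← hsign]
  exact arcCross_of_sides hc hpar hu' hv' (hε u hu).1 (hε u hu).2 (hε v hv).1 (hε v hv).2

end PLKnot

/-! ### Crossing the arc `α`. -/

lemma tri_eq_zero_of_mem_plane {a b x y z : E3} {s t s' t' s'' t'' : ℝ} (hx : x = s • a + t • b)
    (hy : y = s' • a + t' • b) (hz : z = s'' • a + t'' • b) : tri x y z = 0 := by
  subst hx hy hz
  simp [tri_eq]; ring

lemma cross_ne_zero_of_mem_openGreatArc {a b p₁ p₂ : E3} (hab : LinearIndependent ℝ ![a, b])
    (h₁ : p₁ ∈ openGreatArc a b) (h₂ : p₂ ∈ openGreatArc a b) (h : p₁ ≠ p₂) :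
    cross p₁ p₂ ≠ 0 := by
  intro h0
  rcases eq_or_eq_neg_of_cross_eq_zero h₁.1 h₂.1 h0 with e | e
  · exact h e.symm
  · obtain ⟨-, s, t, hs, ht, e₁⟩ := h₁
    obtain ⟨-, s', t', hs', ht', e₂⟩ := h₂
    rw [e₁, e₂] at e
    have := (LinearIndependent.pair_iff.1 hab (s + s') (t + t') (by
      rw [← neg_add_cancel (s • a + t • b), ← e]; module)).1
    linarith

lemma mem_openGreatArc_of_mem {a b p₁ p₂ q : E3} (h₁ : p₁ ∈ openGreatArc a b)
    (h₂ : p₂ ∈ openGreatArc a b) (hq : q ∈ openGreatArc p₁ p₂) : q ∈ openGreatArc a b := by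
  obtain ⟨-, s, t, hs, ht, rfl⟩ := h₁
  obtain ⟨-, s', t', hs', ht', rfl⟩ := h₂
  obtain ⟨hqS, x, y, hx, hy, e⟩ := hq
  exact ⟨hqS, x * s + y * s', x * t + y * t', by positivity, by positivity, by rw [e]; module⟩

theorem proposition2 {m : ℕ} [NeZero m] (K : PLKnot m)
    -- an open arc `α` near which the indicatrix consists of `α` alone
    (α : Set E3) (hα : IsOpenGreatArc α)
    (hαI : ∃ U : Set E3, IsOpen U ∧ K.indicatrix ∩ U = α)
    -- two points of `α`, which orient it
    (p₁ p₂ : E3) (hp₁ : p₁ ∈ α) (hp₂ : p₂ ∈ α) (hp : p₁ ≠ p₂)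
    -- the components along `α` to the south and to the north
    (Ω₀ Ω₁ : Set E3) (hΩ₀ : K.IsComponent Ω₀) (hΩ₁ : K.IsComponent Ω₁)
    (hS : α ⊆ closure (Ω₀ ∩ south p₁ p₂)) (hN : α ⊆ closure (Ω₁ ∩ north p₁ p₂))
    -- any point between `p₁` and `p₂` at which one counts how often the indicatrix runs along `α`
    (q : E3) (hq : q ∈ openGreatArc p₁ p₂) (hqe : ¬ K.IsArcEnd q) :
    ∃ t : ℤ, K.IsTaitNumberOn Ω₀ t ∧
      K.IsTaitNumberOn Ω₁ (t + K.algebraicRuns p₁ p₂ q) := by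
  obtain ⟨U, hU, hαU⟩ := hαI
  obtain ⟨a, -, b, -, hab, rfl⟩ := hα
  have hn := cross_ne_zero_of_mem_openGreatArc hab hp₁ hp₂ hp
  have hqα := mem_openGreatArc_of_mem hp₁ hp₂ hq
  have hplane : ∀ x ∈ openGreatArc a b, ⟪cross p₁ p₂, x⟫ = 0 := by
    rintro x ⟨-, s, t, -, -, hx⟩
    obtain ⟨-, s₁, t₁, -, -, h₁⟩ := hp₁
    obtain ⟨-, s₂, t₂, -, -, h₂⟩ := hp₂
    exact tri_eq_zero_of_mem_plane h₁ h₂ hx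
  obtain ⟨t₀, ht₀⟩ := hΩ₀.exists_hasLocalValue
  obtain ⟨t₁, ht₁⟩ := hΩ₁.exists_hasLocalValue
  -- There are finitely many arcs, so one radius serves all: those through `q` contribute their
  -- sign, and those that miss `q` contribute nothing.
  have hlocal : ∀ᶠ ε in 𝓝[>] (0 : ℝ), ∀ k, ∀ u ∈ ball q ε, ∀ v ∈ ball q ε,
      ⟪cross p₁ p₂, u⟫ < 0 → 0 < ⟪cross p₁ p₂, v⟫ →
      arcCross (K.arc k).1 (K.arc k).2 u v = open Classical in
        if q ∈ greatArc (K.arc k).1 (K.arc k).2 then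
          ((SignType.sign ⟪cross (K.arc k).1 (K.arc k).2, cross p₁ p₂⟫ : SignType) : ℤ)
        else 0 := by
    rw [Filter.eventually_all]
    intro k
    by_cases hk : q ∈ greatArc (K.arc k).1 (K.arc k).2
    · simp only [if_pos hk]
      exact PLKnot.eventually_arcCross_eq hU hαU hn hplane hqα hqe hk
    · simp only [if_neg hk]
      have hcl := isClosed_greatArc (K.arc_mem_S2 k).1 (K.arc_mem_S2 k).2
      filter_upwards [eventually_ball_of_eventually (eventually_normalize_notMem hcl hqα.1 hk)]
        with ε hε u hu v hv _ _
      exact arcCross_eq_zero_of_convex (convex_ball q ε) hε hu hv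
  obtain ⟨ε, hε, hε0⟩ := (hlocal.and (self_mem_nhdsWithin (s := Ioi (0 : ℝ)))).exists
  obtain ⟨ξ₀, hξ₀, hξ₀Ω, hξ₀S⟩ := mem_closure_iff.1 (hS hqα) _ isOpen_ball (mem_ball_self hε0)
  obtain ⟨ξ₁, hξ₁, hξ₁Ω, hξ₁N⟩ := mem_closure_iff.1 (hN hqα) _ isOpen_ball (mem_ball_self hε0)
  have hcont : Continuous fun x : E3 => ⟪cross p₁ p₂, x⟫ := continuous_tri p₁ p₂
  -- The two values are realized at generic vectors near `q`, one on each side; `v` is chosen after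
  -- `u`, in general position to it.
  obtain ⟨u, ⟨hu, huS⟩, hgu, rfl⟩ := (ht₀ ξ₀ hξ₀Ω).exists_mem
    ((isOpen_ball.inter (isOpen_lt hcont continuous_const)).mem_nhds ⟨hξ₀, hξ₀S⟩)
    K.eventually_generic
  obtain ⟨v, ⟨hv, hvN⟩, ⟨hgv, huv⟩, rfl⟩ := (ht₁ ξ₁ hξ₁Ω).exists_mem
    ((isOpen_ball.inter (isOpen_lt continuous_const hcont)).mem_nhds ⟨hξ₁, hξ₁N⟩)
    (K.eventually_generic.and (K.eventually_tri_chord_ne hgu))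
  refine ⟨_, hΩ₀.isTaitNumberOn ht₀, ?_⟩
  have hjump : K.diagramSum u + K.algebraicRuns p₁ p₂ q = K.diagramSum v := by
    rw [eq_comm, ← sub_eq_iff_eq_add', K.diagramSum_sub hgu hgv huv, PLKnot.algebraicRuns]
    exact Finset.sum_congr rfl fun k _ => hε k u hu v hv huS hvN
  rw [hjump]
  exact hΩ₁.isTaitNumberOn ht₁
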